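/- Let $p\ge 1$, $n,m\ge 0$ be integers and let $L\subset\mathbb C$ be a positively oriented smooth (of class $C^p$, with regular parametrization) simple closed contour with inner domain $D^+$. Let $G\subset\mathbb C$ be a domain (open and connected) with $\overline{D^+}=D^+\cup L\subset G$, and let $a_0,\dots,a_n,b_0,\dots,b_m,f$ be analytic in $G$. Put $r=\max(n,m)$, $s=\max(n,m+p-1)$. For $t\in L$ the hypersingular integral $\int_L\frac{\varphi(\tau)\,d\tau}{(\tau-t)^p}$ is understood in the sense of Cauchy and Hadamard, that is, as $$\lim_{v\to0+}\Big[\int_{\{\tau\in L:\,|\tau-t|>v\}}\frac{\varphi(\tau)\,d\tau}{(\tau-t)^p}+\frac{\xi(v)}{v^{p-1}}\Big],$$ where $\xi$ is a polynomial of degree less than $p-1$ ($\xi=0$ if $p=1$) for which the limit exists. Consider (A) $\displaystyle\sum_{k=0}^n a_k(t)x^{(k)}(t)+\sum_{l=0}^m\frac{b_l(t)}{\pi i}\int_L\frac{x^{(l)}(\tau)\,d\tau}{(\tau-t)^p}=f(t)$ for $t\in L$ (all the integrals existing), (B) $\displaystyle\sum_{k=0}^n a_k(z)x^{(k)}(z)+\sum_{l=0}^m\frac{b_l(z)}{(p-1)!}\,x^{(l+p-1)}(z)=f(z)$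 for $z\in G$, and let $A_s(z)$ be the total coefficient of $x^{(s)}$ in (B): it is $a_n$ if $n>m+p-1$, $b_m/(p-1)!$ if $n<m+p-1$, and $a_n+b_m/(p-1)!$ if $n=m+p-1$. Then: 1. A function $x$ analytic in $G$ satisfies (A) if and only if it satisfies (B). 2. If $A_s$ is not identically zero on $G$, then (B) has order $s$: its left-hand side is $\sum_{j=0}^{s}A_jx^{(j)}$ with coefficients $A_j$ analytic in $G$ and $A_s\not\equiv0$. 3. Let $c\in L$ with $A_s(c)\ne0$, and let $x_0,\dots,x_{r-1}\in\mathbb C$. A solution $x$ of (B), analytic in $G$, with the initial conditions $x^{(v)}(c)=x_v$, $v=0,\dots,r-1$, is determined on $G$ by the $s-r$ values $x^{(j)}(c)$, $r\le j<s$. 4. Suppose that $G$ is simply connected and that $A_s$ has no zeros in $G$. Then for every $c\in L$ and all $x_0,\dots,x_{r-1}\in\mathbb C$ the Cauchy problem (B), $x^{(v)}(c)=x_v$ ($v=0,\dots,r-1$), in the class of functions analytic in $G$, has exactly $s-r$ free parameters: there are functions $\varphi_0,\varphi_1,\dots,\varphi_{s-r}$ on $G$ such that the solutions are exactly the functions $\varphi_0+C_1\varphi_1+\dots+C_{s-r}\varphi_{s-r}$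 with arbitrary $C_j\in\mathbb C$, and the constants $C_j$ are uniquely determined by the solution. The same holds for the Cauchy problem for (A). -/

import Mathlib

open Set Filter Topology

/-- `γ`, of period `1`, is a regular parametrization of a smooth simple closed contour in the
plane; the contour itself is `range γ`, and `q` is its class of smoothness. -/
structure IsSmoothClosedContour (q : ℕ) (γ : ℝ → ℂ) : Prop where
  periodic : Function.Periodic γ 1
  contDiff : ContDiff ℝ q γ
  deriv_ne_zero : ∀ u, deriv γ u ≠ 0
  injOn : InjOn γ (Ico 0 1)

/-- The inner domain `D⁺` of the contour: the points off the contour whose connected component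
in the complement of the contour is bounded. -/
def innerDomain (γ : ℝ → ℂ) : Set ℂ :=
  {z | z ∉ range γ ∧ Bornology.IsBounded (connectedComponentIn (range γ)ᶜ z)}

/-- The contour is traversed counterclockwise: it winds once around every inner point. -/
def IsPositivelyOriented (γ : ℝ → ℂ) : Prop :=
  ∀ z ∈ innerDomain γ, ∫ u in (0 : ℝ)..1, deriv γ u / (γ u - z) = 2 * Real.pi * Complex.I

/-- The integral of `φ(τ) / (τ - t) ^ p` over the part `|τ - t| > v` of the contour. -/
noncomputable def truncatedIntegral (γ : ℝ → ℂ) (p : ℕ) (φ : ℂ → ℂ) (t : ℂ) (v : ℝ) : ℂ :=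
  ∫ u in {u : ℝ | u ∈ Ioc (0 : ℝ) 1 ∧ v < ‖γ u - t‖}, φ (γ u) / (γ u - t) ^ p * deriv γ u

/-- The hypersingular integral of `φ(τ) / (τ - t) ^ p` over the contour exists in the sense of
Cauchy and Hadamard and is equal to `I`: with a suitable divergent part `ξ(v) / v ^ (p - 1)`,
`ξ` a polynomial of degree less than `p - 1`, added to the truncated integral, the sum tends to `I`
as `v → 0+`.  For `p = 1` this is the Cauchy principal value. A combination of the powers
`v⁻¹, …, v ^ (-(p - 1))` can only tend to `0`, so `I` is unique. -/
def HasHypersingularIntegral (γ : ℝ → ℂ) (p : ℕ) (φ : ℂ → ℂ) (t I : ℂ) : Prop :=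
  ∃ c : ℕ → ℂ, Tendsto
    (fun v : ℝ => truncatedIntegral γ p φ t v + ∑ k ∈ Finset.Icc 1 (p - 1), c k / (v : ℂ) ^ k)
    (𝓝[>] 0) (𝓝 I)

/-- `x` satisfies the hypersingular integro-differential equation
`∑ a_k(t) x^(k)(t) + ∑ b_l(t)/(π i) ∫_L x^(l)(τ) dτ / (τ - t)^p = f(t)` at all `t ∈ L`, all of the
integrals in it being convergent. -/
def SatisfiesIDE (γ : ℝ → ℂ) (p n m : ℕ) (a b : ℕ → ℂ → ℂ) (f x : ℂ → ℂ) : Prop :=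
  ∀ t ∈ range γ, ∃ I : ℕ → ℂ,
    (∀ l ≤ m, HasHypersingularIntegral γ p (iteratedDeriv l x) t (I l)) ∧
    ∑ k ∈ Finset.range (n + 1), a k t * iteratedDeriv k x t +
      ∑ l ∈ Finset.range (m + 1), b l t / (Real.pi * Complex.I) * I l = f t

/-- The differential expression
`∑ a_k(z) x^(k)(z) + ∑ b_l(z) / (p-1)! x^(l+p-1)(z)`. -/
noncomputable def odeOperator (p n m : ℕ) (a b : ℕ → ℂ → ℂ) (x : ℂ → ℂ) (z : ℂ) : ℂ :=
  ∑ k ∈ Finset.range (n + 1), a k z * iteratedDeriv k x z +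
    ∑ l ∈ Finset.range (m + 1),
      b l z / (Nat.factorial (p - 1) : ℂ) * iteratedDeriv (l + p - 1) x z

/-- `x` satisfies the differential equation `odeOperator x = f` on `G`. -/
def SatisfiesODE (G : Set ℂ) (p n m : ℕ) (a b : ℕ → ℂ → ℂ) (f x : ℂ → ℂ) : Prop :=
  ∀ z ∈ G, odeOperator p n m a b x z = f z

/-- The total coefficient of the derivative of order `max n (m + p - 1)` in `odeOperator`. -/
noncomputable def leadingCoefficient (p n m : ℕ) (a b : ℕ → ℂ → ℂ) (z : ℂ) : ℂ :=
  (if m + p - 1 ≤ n then a n z else 0) +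
    (if n ≤ m + p - 1 then b m z / (Nat.factorial (p - 1) : ℂ) else 0)

/-- `D` is a linear differential operator of order exactly `s` with analytic coefficients on `G`:
it is `∑_{j ≤ s} A_j (d/dz)^j`, and `A_s` is not identically zero. -/
def IsDiffOperatorOfOrder (G : Set ℂ) (D : (ℂ → ℂ) → ℂ → ℂ) (s : ℕ) : Prop :=
  ∃ A : ℕ → ℂ → ℂ, (∀ j ≤ s, AnalyticOnNhd ℂ (A j) G) ∧ (∃ z ∈ G, A s z ≠ 0) ∧
    ∀ x : ℂ → ℂ, AnalyticOnNhd ℂ x G → ∀ z ∈ G,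
      D x z = ∑ j ∈ Finset.range (s + 1), A j z * iteratedDeriv j x z

/-- The initial conditions `x^(v)(c) = x_v`, `v = 0, …, r - 1`. -/
def SatisfiesInitialConditions (r : ℕ) (c : ℂ) (x₀ : Fin r → ℂ) (x : ℂ → ℂ) : Prop :=
  ∀ v : Fin r, iteratedDeriv v x c = x₀ v

/-- The functions of the class `S`, considered on `G`, depend on exactly `d` free parameters: they
are the functions `φ₀ + C_1 φ_1 + ⋯ + C_d φ_d`, where the constants `C_j` are arbitrary and
are determined by the function. -/
def HasFreeParameters (G : Set ℂ) (S : Set (ℂ → ℂ)) (d : ℕ) : Prop :=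
  ∃ (φ₀ : ℂ → ℂ) (φ : Fin d → ℂ → ℂ),
    (∀ x : ℂ → ℂ, x ∈ S ↔ ∃ C : Fin d → ℂ, EqOn x (fun z => φ₀ z + ∑ j, C j * φ j z) G) ∧
    ∀ C C' : Fin d → ℂ,
      EqOn (fun z => φ₀ z + ∑ j, C j * φ j z) (fun z => φ₀ z + ∑ j, C' j * φ j z) G → C = C'

/-! Everything rests on one formula: for `φ` analytic in `G` and `t ∈ L`, the hypersingular integral
of `φ(τ) / (τ - t) ^ p` is `πi φ^(p-1)(t) / (p-1)!`. Repeated division by `τ - t` gives `φ(τ) =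
∑_{j<p} c_j (τ - t)^j + (τ - t)^p ψ(τ)` with `ψ` analytic in `G`. Cauchy's theorem removes `ψ`. The
finite part of `(τ - t)^(-k)` is zero for `k ≥ 2` and `πi` for `k = 1`, so only `c_{p-1} =
φ^(p-1)(t) / (p-1)!` survives.

For `k ≥ 2` the integrand has a single-valued primitive, so the truncated integral depends only on
the two end points of the arc cut off. These are smooth functions of `±v`. Expanding in `v` leaves
negative powers only, because the constant terms of the two ends cancel. For `k = 1` the Cauchy
integral of `1` is compared at the points `t ± iεγ'` of the normal: the difference of its two values
tends to `2πi`, and half their sum tends to the principal value. Both values are winding integrals,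
hence `0` or `2πi`, so their sum is exactly `2πi`. The Jordan curve theorem is not needed:
orientation prescribes the winding integral at inner points, and on unbounded components it is
constant and decays at infinity. Cauchy's theorem itself is obtained by Dixon's argument.

Consequently (A) says that (B) holds on `L`. Both sides of (B) are analytic in `G` and `L` has
accumulation points, so the identity theorem extends (B) to all of `G`
(`satisfiesIDE_iff_satisfiesODE`).

The remaining claims are the theory of linear equations in the complex domain. Uniqueness at a
regular point follows by raising the order of vanishing step by step
(`eventually_eq_zero_of_linear_ode`). Global existence on a simply connected domain is Picard
iteration, each step being the choice of a primitive (`exists_solution_linear_system`); primitives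
come from a section of a covering (`exists_glue_of_locally_const`). The free parameters are then the
derivatives at `c` of orders `r, …, s - 1`. -/

/-! ### Primitives on simply connected domains -/

/-- On a simply connected space, functions defined locally and differing by locally constant
functions are, up to locally constant functions, restrictions of one function. -/
theorem exists_glue_of_locally_const {B ι E : Type*} [TopologicalSpace B] [SimplyConnectedSpace B]
    [LocallyPathConnectedSpace B] [AddCommGroup E] (U : ι → Set B) (hU : ∀ i, IsOpen (U i))
    (idx : B → ι) (hidx : ∀ x, x ∈ U (idx x)) (F : ι → B → E)
    (hF : ∀ i j, ∀ x ∈ U i ∩ U j, ∀ᶠ y in 𝓝 x, F i y - F j y = F i x - F j x) :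
    ∃ P : B → E, ∀ i, ∀ x ∈ U i, ∀ᶠ y in 𝓝 x, P y - F i y = P x - F i x := by
  let _ : TopologicalSpace E := ⊥
  have : DiscreteTopology E := ⟨rfl⟩
  -- The transition maps are translations by `F i - F j`, locally constant by `hF`. With a discrete
  -- fibre the bundle is therefore a covering, and lifting the identity map gives a global section.
  -- The sum of its coordinate in chart `i` and `F i` does not depend on `i`; this sum is `P`.
  let Z : FiberBundleCore ι B E :=
    { baseSet := U
      isOpen_baseSet := hU
      indexAt := idx
      mem_baseSet_at := hidx
      coordChange := fun i j x v => v + (F i x - F j x)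
      coordChange_self := by intro i x _ v; simp
      continuousOn_coordChange := by
        rintro i j ⟨x, v⟩ ⟨hx, -⟩
        apply ContinuousAt.continuousWithinAt
        have h1 : (fun p : B × E => p.2 + (F i p.1 - F j p.1)) =ᶠ[𝓝 (x, v)]
            fun p => p.2 + (F i x - F j x) := by
          have := (continuous_fst.tendsto (x, v)).eventually (hF i j x hx)
          filter_upwards [this] with p hp
          rw [hp]
        refine ContinuousAt.congr ?_ h1.symm
        exact (continuous_of_discreteTopology (f := fun e : E => e + (F i x - F j x))).comp
          continuous_snd |>.continuousAt
      coordChange_comp := by intro i j k x _ v; abel }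
  have hcov : IsCoveringMap (Bundle.TotalSpace.proj : Z.TotalSpace → B) :=
    FiberBundle.isCoveringMap
  obtain ⟨x₀⟩ : Nonempty B := inferInstance
  obtain ⟨s, ⟨-, hs⟩, -⟩ := hcov.existsUnique_continuousMap_lifts (ContinuousMap.id B) x₀
    (⟨x₀, (0 : E)⟩ : Z.TotalSpace) rfl
  have hs' : ∀ x, (s x).proj = x := fun x => congrFun hs x
  refine ⟨fun x => (show E from (s x).2) + F (idx x) x, fun i x hx => ?_⟩
  have hmem : s x ∈ (Z.localTriv i).source := by
    rw [Z.mem_localTriv_source]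
    exact (hs' x).symm ▸ hx
  have hc : ContinuousAt (fun y => (Z.localTriv i (s y)).2) x :=
    continuous_snd.continuousAt.comp
      (((Z.localTriv i).continuousAt hmem).comp s.continuous.continuousAt)
  have := hc.eventually (IsOpen.mem_nhds (isOpen_discrete {(Z.localTriv i (s x)).2}) rfl)
  have key : ∀ y, (Z.localTriv i (s y)).2 =
      (show E from (s y).2) + F (idx y) y - F i y := by
    intro y
    rw [Z.localTriv_apply]
    show (show E from (s y).2) + (F (idx (s y).proj) (s y).proj - F i (s y).proj) = _
    rw [hs' y]; abel
  filter_upwards [this] with y hy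
  have hy' : (Z.localTriv i (s y)).2 = (Z.localTriv i (s x)).2 := hy
  rw [key, key] at hy'
  exact hy'

/-- A holomorphic function on a simply connected open set has a primitive. -/
theorem DifferentiableOn.isExactOn_of_isSimplyConnected {E : Type*} [NormedAddCommGroup E]
    [NormedSpace ℂ E] [CompleteSpace E] {G : Set ℂ} (hG : IsOpen G) (hs : IsSimplyConnected G)
    {f : ℂ → E} (hf : DifferentiableOn ℂ f G) : Complex.IsExactOn f G := by
  have := hs.simplyConnectedSpace
  have := hG.locallyPathConnectedSpace
  have hball : ∀ x : G, ∃ r > 0, Metric.ball (x : ℂ) r ⊆ G := fun x =>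
    Metric.isOpen_iff.1 hG x x.2
  choose r hr hrG using hball
  have hprim : ∀ x : G, ∃ F : ℂ → E, ∀ z ∈ Metric.ball (x : ℂ) (r x), HasDerivAt F (f z) z :=
    fun x => (hf.mono (hrG x)).isExactOn_ball
  choose F hF using hprim
  obtain ⟨P, hP⟩ := exists_glue_of_locally_const (B := G) (ι := G) (E := E)
    (fun i => Subtype.val ⁻¹' Metric.ball (i : ℂ) (r i))
    (fun i => Metric.isOpen_ball.preimage continuous_subtype_val) id
    (fun x => Metric.mem_ball_self (hr x)) (fun i x => F i x) (by
      rintro i j x ⟨hxi, hxj⟩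
      -- Primitives on two discs differ by a constant on the intersection, which is convex.
      have hd : ∀ z ∈ Metric.ball (i : ℂ) (r i) ∩ Metric.ball (j : ℂ) (r j),
          HasDerivAt (fun z => F i z - F j z) 0 z := by
        intro z hz
        simpa using (hF i z hz.1).fun_sub (hF j z hz.2)
      have hconst : ∀ᶠ z in 𝓝 (x : ℂ), F i z - F j z = F i x - F j x := by
        filter_upwards [(Metric.isOpen_ball.inter Metric.isOpen_ball).mem_nhds
          (show (x : ℂ) ∈ Metric.ball (i : ℂ) (r i) ∩ Metric.ball (j : ℂ) (r j) from
            ⟨hxi, hxj⟩)] with z hz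
        exact ((convex_ball _ _).inter (convex_ball _ _)).is_const_of_fderivWithin_eq_zero
          (𝕜 := ℂ) (f := fun z => F i z - F j z)
          (fun w hw => (hd w hw).differentiableAt.differentiableWithinAt)
          (fun w hw => by
            rw [fderivWithin_of_isOpen (Metric.isOpen_ball.inter Metric.isOpen_ball) hw]
            ext
            simp [(hd w hw).deriv]) hz ⟨hxi, hxj⟩
      exact (continuous_subtype_val.tendsto x).eventually hconst)
  classical
  refine ⟨fun z => if h : z ∈ G then P ⟨z, h⟩ else 0, fun z hz => ?_⟩
  have h1 := hP ⟨z, hz⟩ ⟨z, hz⟩ (Metric.mem_ball_self (hr _))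
  rw [nhds_subtype_eq_comap, eventually_comap] at h1
  have h2 : (fun w => if h : w ∈ G then P ⟨w, h⟩ else 0) =ᶠ[𝓝 z]
      fun w => F ⟨z, hz⟩ w + (P ⟨z, hz⟩ - F ⟨z, hz⟩ z) := by
    filter_upwards [h1, hG.mem_nhds hz] with w hw hwG
    have := hw ⟨w, hwG⟩ rfl
    rw [dif_pos hwG, ← this]; abel
  exact ((hF ⟨z, hz⟩ z (Metric.mem_ball_self (hr _))).add_const _).congr_of_eventuallyEq h2

/-! ### Linear systems: global Picard iteration -/

/-- Integration along the segment from `w` to `z` turns a bound with `k!` for `D k` into one with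
`(k+1)!` for `D (k+1)`. The values at `w` need not vanish, only obey a bound of the same type; this
lets the estimate be carried from one disc to the next. -/
theorem norm_le_of_deriv_chain {E : Type*} [NormedAddCommGroup E] [NormedSpace ℂ E]
    {D D' : ℕ → ℂ → E} {w : ℂ} {r C M K : ℝ} (hK : 0 ≤ K)
    (hD : ∀ k, ∀ z ∈ Metric.ball w r, HasDerivAt (D (k + 1)) (D' k z) z)
    (hD' : ∀ k, ∀ z ∈ Metric.ball w r, ‖D' k z‖ ≤ K * ‖D k z‖)
    (h0 : ∀ z ∈ Metric.ball w r, ‖D 0 z‖ ≤ C)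
    (hw : ∀ k, ‖D k w‖ ≤ C * M ^ k / k.factorial) (k : ℕ) :
    ∀ z ∈ Metric.ball w r, ‖D k z‖ ≤ C * (M + K * ‖z - w‖) ^ k / k.factorial := by
  induction k with
  | zero => simpa using h0
  | succ k ih =>
    intro z hz
    have hmem : ∀ u ∈ Icc (0 : ℝ) 1, w + (u : ℂ) * (z - w) ∈ Metric.ball w r := by
      intro u hu
      rw [mem_ball_iff_norm, add_sub_cancel_left, norm_mul, Complex.norm_real, Real.norm_eq_abs,
        abs_of_nonneg hu.1]
      rw [mem_ball_iff_norm] at hz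
      exact (mul_le_of_le_one_left (norm_nonneg _) hu.2).trans_lt hz
    have hline : ∀ u : ℝ, HasDerivAt (fun u : ℝ => w + (u : ℂ) * (z - w)) (z - w) u := by
      intro u
      simpa using ((Complex.ofRealCLM.hasDerivAt (x := u)).mul_const (z - w)).const_add w
    have hf : ∀ u ∈ Icc (0 : ℝ) 1, HasDerivAt (fun u : ℝ => D (k + 1) (w + (u : ℂ) * (z - w)))
        ((z - w) • D' k (w + (u : ℂ) * (z - w))) u := by
      intro u hu
      exact (hD k _ (hmem u hu)).scomp u (hline u)
    have hB : ∀ u : ℝ, HasDerivAt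
        (fun u : ℝ => C * (M + K * (u * ‖z - w‖)) ^ (k + 1) / (k + 1).factorial)
        (C * (M + K * (u * ‖z - w‖)) ^ k / k.factorial * (K * ‖z - w‖)) u := by
      intro u
      have h1 : HasDerivAt (fun u : ℝ => M + K * (u * ‖z - w‖)) (K * ‖z - w‖) u := by
        simpa using (((hasDerivAt_id u).mul_const ‖z - w‖).const_mul K).const_add M
      refine (((h1.fun_pow (k + 1)).const_mul C).div_const ((k + 1).factorial : ℝ)).congr_deriv ?_
      have h2 : ((k.factorial : ℕ) : ℝ) ≠ 0 := by positivity
      rw [Nat.factorial_succ]; push_cast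
      have h3 : ((k : ℝ) + 1) ≠ 0 := by positivity
      field_simp
    have := image_norm_le_of_norm_deriv_right_le_deriv_boundary (a := 0) (b := 1)
      (f := fun u : ℝ => D (k + 1) (w + (u : ℂ) * (z - w)))
      (f' := fun u : ℝ => (z - w) • D' k (w + (u : ℂ) * (z - w)))
      (fun u hu => (hf u hu).continuousAt.continuousWithinAt)
      (fun u hu => (hf u ⟨hu.1, hu.2.le⟩).hasDerivWithinAt)
      (B := fun u : ℝ => C * (M + K * (u * ‖z - w‖)) ^ (k + 1) / (k + 1).factorial)
      (by simpa using hw (k + 1)) hB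
      (by
        intro u hu
        have hu' : u ∈ Icc (0 : ℝ) 1 := ⟨hu.1, hu.2.le⟩
        have h1 := hD' k _ (hmem u hu')
        have h2 := ih _ (hmem u hu')
        rw [add_sub_cancel_left, norm_mul, Complex.norm_real, Real.norm_eq_abs,
          abs_of_nonneg hu.1] at h2
        rw [norm_smul]
        calc _ ≤ ‖z - w‖ * (K * (C * (M + K * (u * ‖z - w‖)) ^ k / k.factorial)) := by gcongr; exact h1.trans (by gcongr)
          _ = _ := by ring)
      (show (1 : ℝ) ∈ Icc (0 : ℝ) 1 by simp)
    simpa using this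

/-- Linear systems with holomorphic coefficients on a simply connected domain have global
solutions with prescribed initial value. -/
theorem exists_solution_linear_system {E : Type*} [NormedAddCommGroup E] [NormedSpace ℂ E]
    [CompleteSpace E] {G : Set ℂ} (hG : IsOpen G) (hs : IsSimplyConnected G)
    {B : ℂ → E →L[ℂ] E} {F : ℂ → E} (hB : DifferentiableOn ℂ B G) (hF : DifferentiableOn ℂ F G)
    {c : ℂ} (hc : c ∈ G) (y₀ : E) :
    ∃ Y : ℂ → E, Y c = y₀ ∧ ∀ z ∈ G, HasDerivAt Y (B z (Y z) + F z) z := by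
  -- One Picard step, with a primitive in place of the integral from `c` to `z`.
  have hstep : ∀ Y : {Y : ℂ → E // DifferentiableOn ℂ Y G}, ∃ Y' : {Y : ℂ → E // DifferentiableOn ℂ Y G},
      Y'.1 c = y₀ ∧ ∀ z ∈ G, HasDerivAt Y'.1 (B z (Y.1 z) + F z) z := by
    intro Y
    obtain ⟨g, hg, hg'⟩ := (((hB.clm_apply Y.2).fun_add hF).isExactOn_of_isSimplyConnected
      hG hs).with_val_at c y₀
    exact ⟨⟨g, fun z hz => (hg' z hz).differentiableAt.differentiableWithinAt⟩, hg, hg'⟩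
  choose N hN hN' using hstep
  let Y : ℕ → {Y : ℂ → E // DifferentiableOn ℂ Y G} := fun k =>
    N^[k] ⟨fun _ => y₀, differentiableOn_const _⟩
  have hY0 : (Y 0).1 = fun _ => y₀ := rfl
  have hYs : ∀ k, Y (k + 1) = N (Y k) := fun k => Function.iterate_succ_apply' _ _ _
  have hYc : ∀ k, (Y k).1 c = y₀ := by
    rintro (_ | k)
    · rfl
    · rw [hYs]; exact hN _
  have hYd : ∀ k, ∀ z ∈ G, HasDerivAt (Y (k + 1)).1 (B z ((Y k).1 z) + F z) z := by
    intro k z hz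
    rw [hYs]; exact hN' _ z hz
  let D : ℕ → ℂ → E := fun k z => (Y (k + 1)).1 z - (Y k).1 z
  have hDc : ∀ k, D k c = 0 := fun k => by simp [D, hYc]
  have hD0 : ∀ z ∈ G, HasDerivAt (D 0) (B z y₀ + F z) z := by
    intro z hz
    simpa [D, hY0] using (hYd 0 z hz).sub_const y₀
  have hDs : ∀ k, ∀ z ∈ G, HasDerivAt (D (k + 1)) (B z (D k z)) z := by
    intro k z hz
    have := (hYd (k + 1) z hz).fun_sub (hYd k z hz)
    simpa [D] using this
  have hDd : ∀ k, DifferentiableOn ℂ (D k) G := fun k => (Y (k + 1)).2.fun_sub (Y k).2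
  -- The points where the Picard increments obey some factorial bound. By `hloc` a bound at one
  -- point of a small disc gives a bound on the whole disc, so `S` is open and relatively closed in
  -- `G`. It contains `c`, where all increments vanish.
  let S : Set ℂ := {w | w ∈ G ∧ ∃ C M : ℝ, 0 ≤ C ∧ 0 ≤ M ∧ ∀ k : ℕ, ‖D k w‖ ≤ C * M ^ k / k.factorial}
  have hloc : ∀ w₀ ∈ G, ∃ r > 0, Metric.ball w₀ r ⊆ G ∧ ∀ w ∈ Metric.ball w₀ r, w ∈ S →
      ∃ C M : ℝ, 0 ≤ C ∧ 0 ≤ M ∧ ∀ z ∈ Metric.ball w₀ r, ∀ k : ℕ,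
        ‖D k z‖ ≤ C * M ^ k / k.factorial := by
    intro w₀ hw₀
    have hBc : ContinuousAt B w₀ := (hB.continuousOn).continuousAt (hG.mem_nhds hw₀)
    have hDc0 : ContinuousAt (D 0) w₀ := (hDd 0).continuousOn.continuousAt (hG.mem_nhds hw₀)
    obtain ⟨R, hR, hRb⟩ := Metric.eventually_nhds_iff_ball.1
      ((hBc.norm.eventually_lt_const (lt_add_one _)).and
        ((hDc0.norm.eventually_lt_const (lt_add_one _)).and (hG.mem_nhds hw₀)))
    -- For `w` in the disc of radius `R / 3` about `w₀`, the disc of radius `2R / 3` about `w`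
    -- contains that disc and stays inside the disc of radius `R`, where `B` and `D 0` are bounded.
    refine ⟨R / 3, by positivity, fun z hz => (hRb z (Metric.ball_subset_ball (by linarith) hz)).2.2, ?_⟩
    rintro w hw ⟨hwG, C, M, hC, hM, hCM⟩
    have hsub : Metric.ball w (2 * R / 3) ⊆ Metric.ball w₀ R :=
      Metric.ball_subset_ball' (by rw [Metric.mem_ball] at hw; linarith)
    have hC' : C ≤ max C (‖D 0 w₀‖ + 1) := le_max_left _ _
    refine ⟨max C (‖D 0 w₀‖ + 1), M + (‖B w₀‖ + 1) * (2 * R / 3), hC.trans hC', by positivity, ?_⟩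
    intro z hz k
    have hzw : z ∈ Metric.ball w (2 * R / 3) := by
      rw [Metric.mem_ball] at *
      have := dist_triangle_right z w w₀
      linarith
    refine (norm_le_of_deriv_chain (D' := fun k z => B z (D k z)) (r := 2 * R / 3)
      (K := ‖B w₀‖ + 1)
      (by positivity) (fun k z hz => hDs k z (hRb z (hsub hz)).2.2)
      (fun k z hz => ((B z).le_opNorm _).trans (by gcongr; exact (hRb z (hsub hz)).1.le))
      (fun z hz => (hRb z (hsub hz)).2.1.le.trans (le_max_right _ _))
      (fun k => (hCM k).trans (by gcongr)) k z hzw).trans ?_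
    rw [mem_ball_iff_norm] at hzw
    gcongr
  have hSG : G ⊆ S := by
    have hcS : c ∈ S := ⟨hc, 0, 0, le_rfl, le_rfl, fun k => by simp [hDc]⟩
    refine hs.isPathConnected.isConnected.isPreconnected.subset_of_closure_inter_subset ?_ ⟨c, hc, hcS⟩ ?_
    · rw [isOpen_iff_mem_nhds]
      intro w hw
      obtain ⟨r, hr, hrG, h⟩ := hloc w hw.1
      obtain ⟨C, M, hC, hM, h⟩ := h w (Metric.mem_ball_self hr) hw
      filter_upwards [Metric.ball_mem_nhds w hr] with z hz
      exact ⟨hrG hz, C, M, hC, hM, h z hz⟩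
    · rintro w ⟨hw, hwG⟩
      obtain ⟨r, hr, hrG, h⟩ := hloc w hwG
      obtain ⟨v, hv, hvS⟩ := mem_closure_iff_nhds.1 hw _ (Metric.ball_mem_nhds w hr)
      obtain ⟨C, M, hC, hM, h⟩ := h v hv hvS
      exact ⟨hwG, C, M, hC, hM, h w (Metric.mem_ball_self hr)⟩
  refine ⟨fun z => y₀ + ∑' k, D k z, by simp [hDc], fun z hz => ?_⟩
  obtain ⟨r, hr, hrG, h⟩ := hloc z hz
  obtain ⟨C, M, hC, hM, h⟩ := h z (Metric.mem_ball_self hr) (hSG hz)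
  have hsum : Summable fun k : ℕ => C * M ^ k / k.factorial := by
    simpa [mul_div_assoc] using (Real.summable_pow_div_factorial M).mul_left C
  have hdiff := Complex.differentiableOn_tsum_of_summable_norm hsum
    (fun k => (hDd k).mono hrG) Metric.isOpen_ball (fun k w hw => h w hw k)
  have hder := Complex.hasSum_deriv_of_summable_norm hsum
    (fun k => (hDd k).mono hrG) Metric.isOpen_ball (fun k w hw => h w hw k)
    (Metric.mem_ball_self hr)
  have hsD : Summable fun k => D k z :=
    Summable.of_norm_bounded hsum (h z (Metric.mem_ball_self hr))
  -- The term `D 0` contributes `B y₀ + F`, and each `D (k + 1)` contributes `B (D k)`; hence the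
  -- index shift.
  have h1 : HasSum (fun k => deriv (D k) z) (B z (y₀ + ∑' k, D k z) + F z) := by
    rw [← hasSum_nat_add_iff' 1]
    simp only [Finset.range_one, Finset.sum_singleton, (hD0 z hz).deriv, (hDs _ z hz).deriv, map_add]
    convert (B z).hasSum hsD.hasSum using 1
    abel
  have h2 := (hdiff.differentiableAt (Metric.ball_mem_nhds z hr)).hasDerivAt
  rw [hder.unique h1] at h2
  exact h2.const_add y₀

/-! ### Linear differential equations of order `s` -/

theorem iteratedDeriv_iteratedDeriv (i j : ℕ) (x : ℂ → ℂ) :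
    iteratedDeriv i (iteratedDeriv j x) = iteratedDeriv (i + j) x := by
  simp only [iteratedDeriv_eq_iterate, Function.iterate_add_apply]

theorem analyticAt_iteratedDeriv {x : ℂ → ℂ} {c : ℂ} (hx : AnalyticAt ℂ x c) (j : ℕ) :
    AnalyticAt ℂ (iteratedDeriv j x) c := by
  rw [iteratedDeriv_eq_iterate]; exact hx.iterated_deriv j

theorem le_analyticOrderAt_sum {ι : Type*} (s : Finset ι) (g : ι → ℂ → ℂ) (c : ℂ) (N : ℕ∞)
    (h : ∀ i ∈ s, N ≤ analyticOrderAt (g i) c) :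
    N ≤ analyticOrderAt (fun z => ∑ i ∈ s, g i z) c := by
  classical
  induction s using Finset.induction_on with
  | empty =>
    have : analyticOrderAt (fun _ : ℂ => (0 : ℂ)) c = ⊤ := analyticOrderAt_eq_top.2 (by simp)
    simp [this]
  | insert i s hi ih =>
    simp only [Finset.sum_insert hi]
    exact (le_min (h i (by simp)) (ih fun j hj => h j (by simp [hj]))).trans le_analyticOrderAt_add

/-- A solution of a homogeneous linear differential equation with zero initial data at a regular
point vanishes near this point. -/
theorem eventually_eq_zero_of_linear_ode {s : ℕ} {A : ℕ → ℂ → ℂ} {x : ℂ → ℂ} {c : ℂ}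
    (hA : ∀ j ≤ s, AnalyticAt ℂ (A j) c) (hs : A s c ≠ 0) (hx : AnalyticAt ℂ x c)
    (hode : ∀ᶠ z in 𝓝 c, ∑ j ∈ Finset.range (s + 1), A j z * iteratedDeriv j x z = 0)
    (h0 : ∀ j < s, iteratedDeriv j x c = 0) : ∀ᶠ z in 𝓝 c, x z = 0 := by
  rw [← analyticOrderAt_eq_top, ENat.eq_top_iff_forall_ge]
  -- If `x` vanishes at `c` to order `s + k`, then `x^(j)` with `j < s` vanishes to order at least
  -- `k + 1`. By the equation so does `A_s x^(s)`, and `A_s(c) ≠ 0` lets `x^(s)` inherit this. Hence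
  -- `x` vanishes to order `s + k + 1`.
  have key : ∀ k : ℕ, ((s + k : ℕ) : ℕ∞) ≤ analyticOrderAt x c := by
    intro k
    induction k with
    | zero => exact (natCast_le_analyticOrderAt_iff_iteratedDeriv_eq_zero hx).2 h0
    | succ k ih =>
      rw [natCast_le_analyticOrderAt_iff_iteratedDeriv_eq_zero hx] at ih ⊢
      have hlow : ∀ j ∈ Finset.range s, ((k + 1 : ℕ) : ℕ∞) ≤
          analyticOrderAt (fun z => -(A j z * iteratedDeriv j x z)) c := by
        intro j hj
        rw [Finset.mem_range] at hj
        have h1 : ((k + 1 : ℕ) : ℕ∞) ≤ analyticOrderAt (iteratedDeriv j x) c := by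
          rw [natCast_le_analyticOrderAt_iff_iteratedDeriv_eq_zero (analyticAt_iteratedDeriv hx j)]
          intro i hi
          rw [iteratedDeriv_iteratedDeriv]
          exact ih _ (by omega)
        have h2 : analyticOrderAt (fun z => -(A j z * iteratedDeriv j x z)) c =
            analyticOrderAt (A j) c + analyticOrderAt (iteratedDeriv j x) c := by
          rw [← analyticOrderAt_mul (hA j hj.le) (analyticAt_iteratedDeriv hx j),
            ← analyticOrderAt_neg]
          congr 1
          ext z
          simp
        rw [h2]
        exact h1.trans le_add_self
      have hsum := le_analyticOrderAt_sum _ _ c _ hlow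
      have heq : (fun z => ∑ j ∈ Finset.range s, -(A j z * iteratedDeriv j x z)) =ᶠ[𝓝 c]
          A s * iteratedDeriv s x := by
        filter_upwards [hode] with z hz
        rw [Finset.sum_range_succ] at hz
        rw [Finset.sum_neg_distrib, Pi.mul_apply]
        linear_combination -hz
      rw [analyticOrderAt_congr heq, analyticOrderAt_mul (hA s le_rfl) (analyticAt_iteratedDeriv hx s),
        (hA s le_rfl).analyticOrderAt_eq_zero.2 hs, zero_add,
        natCast_le_analyticOrderAt_iff_iteratedDeriv_eq_zero (analyticAt_iteratedDeriv hx s)] at hsum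
      intro i hi
      rcases lt_or_ge i s with h | h
      · exact h0 i h
      · have := hsum (i - s) (by omega)
        rwa [iteratedDeriv_iteratedDeriv, Nat.sub_add_cancel h] at this
  intro k
  exact (by exact_mod_cast Nat.le_add_left k s : (k : ℕ∞) ≤ ((s + k : ℕ) : ℕ∞)).trans (key k)

/-- The Cauchy problem at a regular point has at most one solution. -/
theorem eqOn_of_linear_ode {G : Set ℂ} (hG : IsOpen G) (hGc : IsPreconnected G) {s : ℕ}
    {A : ℕ → ℂ → ℂ} {f x y : ℂ → ℂ} {c : ℂ} (hc : c ∈ G)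
    (hA : ∀ j ≤ s, AnalyticOnNhd ℂ (A j) G) (hs : A s c ≠ 0)
    (hx : AnalyticOnNhd ℂ x G) (hy : AnalyticOnNhd ℂ y G)
    (hxf : ∀ z ∈ G, ∑ j ∈ Finset.range (s + 1), A j z * iteratedDeriv j x z = f z)
    (hyf : ∀ z ∈ G, ∑ j ∈ Finset.range (s + 1), A j z * iteratedDeriv j y z = f z)
    (h0 : ∀ j < s, iteratedDeriv j x c = iteratedDeriv j y c) : EqOn x y G := by
  have hsub : ∀ z ∈ G, ∀ j, iteratedDeriv j (x - y) z = iteratedDeriv j x z - iteratedDeriv j y z :=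
    fun z hz j => iteratedDeriv_sub (hx z hz).contDiffAt (hy z hz).contDiffAt
  refine hx.eqOn_of_preconnected_of_eventuallyEq hy hGc hc ?_
  have := eventually_eq_zero_of_linear_ode (x := x - y) (fun j hj => hA j hj c hc) hs
    ((hx c hc).sub (hy c hc)) ?_ ?_
  · filter_upwards [this] with z hz using sub_eq_zero.1 hz
  · filter_upwards [hG.mem_nhds hc] with z hz
    simp only [hsub z hz, mul_sub, Finset.sum_sub_distrib, hxf z hz, hyf z hz, sub_self]
  · intro j hj
    rw [hsub c hc, h0 j hj, sub_self]

/-- The Cauchy problem for a linear differential equation with analytic coefficients and no singular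
points in a simply connected domain has a global solution. -/
theorem exists_solution_linear_ode {G : Set ℂ} (hG : IsOpen G) (hGs : IsSimplyConnected G) {s : ℕ}
    {A : ℕ → ℂ → ℂ} {f : ℂ → ℂ} (hA : ∀ j ≤ s, AnalyticOnNhd ℂ (A j) G)
    (hf : AnalyticOnNhd ℂ f G) (hs : ∀ z ∈ G, A s z ≠ 0) {c : ℂ} (hc : c ∈ G) (y : ℕ → ℂ) :
    ∃ x : ℂ → ℂ, AnalyticOnNhd ℂ x G ∧
      (∀ z ∈ G, ∑ j ∈ Finset.range (s + 1), A j z * iteratedDeriv j x z = f z) ∧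
      ∀ j < s, iteratedDeriv j x c = y j := by
  -- Order zero is division by `A 0`. Otherwise the order is `s + 1` and the companion system for
  -- `(x, x', …, x^(s))` is used: `T` shifts the components and `e` is the last basis vector.
  rcases s with _ | s
  · refine ⟨fun z => f z / A 0 z, fun z hz => (hf z hz).div (hA 0 le_rfl z hz) (hs z hz),
      fun z hz => ?_, by simp⟩
    have := hs z hz
    simp [mul_div_cancel₀, this]
  let T : (Fin (s + 1) → ℂ) →L[ℂ] (Fin (s + 1) → ℂ) := ContinuousLinearMap.pi fun i =>
    if h : (i : ℕ) + 1 < s + 1 then ContinuousLinearMap.proj (R := ℂ) (⟨i + 1, h⟩ : Fin (s + 1)) else 0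
  let e : Fin (s + 1) → ℂ := Pi.single (Fin.last s) 1
  let B : ℂ → (Fin (s + 1) → ℂ) →L[ℂ] (Fin (s + 1) → ℂ) := fun z => T - ∑ j : Fin (s + 1), (A j z / A (s + 1) z) •
    (ContinuousLinearMap.proj (R := ℂ) j : (Fin (s + 1) → ℂ) →L[ℂ] ℂ).smulRight e
  let F : ℂ → Fin (s + 1) → ℂ := fun z => (f z / A (s + 1) z) • e
  have hAs : DifferentiableOn ℂ (A (s + 1)) G := (hA _ le_rfl).differentiableOn
  have hB : DifferentiableOn ℂ B G := by
    refine (differentiableOn_const _).fun_sub (DifferentiableOn.fun_sum fun j _ => ?_)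
    exact ((hA j (by omega)).differentiableOn.fun_div hAs hs).smul_const _
  have hF : DifferentiableOn ℂ F G := (hf.differentiableOn.fun_div hAs hs).smul_const _
  obtain ⟨Y, hYc, hY⟩ := exists_solution_linear_system hG hGs hB hF hc (fun i => y i)
  have hYi : ∀ z ∈ G, ∀ i : Fin (s + 1), HasDerivAt (fun z => Y z i) ((B z (Y z) + F z) i) z :=
    fun z hz i => hasDerivAt_pi.1 (hY z hz) i
  have hnext : ∀ z ∈ G, ∀ i (hi : i < s), HasDerivAt (fun z => Y z ⟨i, by omega⟩)
      (Y z ⟨i + 1, by omega⟩) z := by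
    intro z hz i hi
    convert hYi z hz ⟨i, by omega⟩ using 1
    have hne : (⟨i, by omega⟩ : Fin (s + 1)) ≠ Fin.last s := by
      intro h; have := congrArg Fin.val h; simp at this; omega
    simp [B, F, T, e, hi, hne]
  have hlast : ∀ z ∈ G, HasDerivAt (fun z => Y z (Fin.last s))
      (f z / A (s + 1) z - ∑ j : Fin (s + 1), A j z / A (s + 1) z * Y z j) z := by
    intro z hz
    convert hYi z hz (Fin.last s) using 1
    simp [B, F, T, e]
    ring
  have hder : ∀ j (hj : j < s + 1), ∀ z ∈ G, iteratedDeriv j (fun z => Y z 0) z = Y z ⟨j, hj⟩ := by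
    intro j
    induction j with
    | zero => intro _ z _; simp
    | succ j ih =>
      intro hj z hz
      rw [iteratedDeriv_succ]
      have : iteratedDeriv j (fun z => Y z 0) =ᶠ[𝓝 z] fun z => Y z ⟨j, by omega⟩ := by
        filter_upwards [hG.mem_nhds hz] with w hw using ih (by omega) w hw
      rw [this.deriv_eq]
      exact (hnext z hz j (by omega)).deriv
  refine ⟨fun z => Y z 0, ?_, fun z hz => ?_, fun j hj => ?_⟩
  · refine DifferentiableOn.analyticOnNhd (fun z hz => ?_) hG
    exact (hYi z hz 0).differentiableAt.differentiableWithinAt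
  · have h1 : iteratedDeriv (s + 1) (fun z => Y z 0) z =
        f z / A (s + 1) z - ∑ j : Fin (s + 1), A j z / A (s + 1) z * Y z j := by
      rw [iteratedDeriv_succ]
      have : iteratedDeriv s (fun z => Y z 0) =ᶠ[𝓝 z] fun z => Y z (Fin.last s) := by
        filter_upwards [hG.mem_nhds hz] with w hw using hder s (by omega) w hw
      rw [this.deriv_eq]
      exact (hlast z hz).deriv
    rw [Finset.sum_range_succ, h1, Finset.sum_range]
    simp only [hder _ (Fin.is_lt _) z hz, Fin.eta]
    have hne := hs z hz
    rw [mul_sub, mul_div_cancel₀ _ hne, Finset.mul_sum]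
    have : ∀ j : Fin (s + 1), A (s + 1) z * (A j z / A (s + 1) z * Y z j) = A j z * Y z j := by
      intro j; field_simp
    simp only [this]
    ring
  · rw [hder j hj c hc, hYc]

/-- The Cauchy problem for a linear differential equation of order `s` without singular points, with
`r ≤ s` prescribed initial values, has `s - r` free parameters. -/
theorem hasFreeParameters_linear_ode {G : Set ℂ} (hG : IsOpen G) (hGs : IsSimplyConnected G)
    {r s : ℕ} (hrs : r ≤ s) {A : ℕ → ℂ → ℂ} {f : ℂ → ℂ} (hA : ∀ j ≤ s, AnalyticOnNhd ℂ (A j) G)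
    (hf : AnalyticOnNhd ℂ f G) (hs : ∀ z ∈ G, A s z ≠ 0) {c : ℂ} (hc : c ∈ G) (x₀ : Fin r → ℂ) :
    HasFreeParameters G
      {x | AnalyticOnNhd ℂ x G ∧
        (∀ z ∈ G, ∑ j ∈ Finset.range (s + 1), A j z * iteratedDeriv j x z = f z) ∧
        SatisfiesInitialConditions r c x₀ x} (s - r) := by
  -- `φ₀` carries the prescribed data, completed by zeros in orders `r, …, s - 1`. The homogeneous
  -- solution `φ i` has the single nonzero datum `1` in order `r + i`. The constant `C i` is
  -- therefore the derivative of order `r + i` at `c`.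
  obtain ⟨φ₀, hφ₀, hφ₀f, hφ₀c⟩ := exists_solution_linear_ode hG hGs hA hf hs hc
    (fun j => if h : j < r then x₀ ⟨j, h⟩ else 0)
  have hex : ∀ i : Fin (s - r), ∃ x : ℂ → ℂ, AnalyticOnNhd ℂ x G ∧
      (∀ z ∈ G, ∑ j ∈ Finset.range (s + 1), A j z * iteratedDeriv j x z = 0) ∧
      ∀ j < s, iteratedDeriv j x c = if j = r + i then 1 else 0 := fun i =>
    exists_solution_linear_ode hG hGs hA (f := fun _ => 0) analyticOnNhd_const hs hc _
  choose φ hφ hφf hφc using hex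
  have han : ∀ C : Fin (s - r) → ℂ, AnalyticOnNhd ℂ (fun z => φ₀ z + ∑ j, C j * φ j z) G := by
    intro C z hz
    exact (hφ₀ z hz).fun_add (Finset.analyticAt_fun_sum _ fun j _ =>
      analyticAt_const.fun_mul (hφ j z hz))
  have hder : ∀ (C : Fin (s - r) → ℂ), ∀ z ∈ G, ∀ k,
      iteratedDeriv k (fun z => φ₀ z + ∑ j, C j * φ j z) z =
        iteratedDeriv k φ₀ z + ∑ j, C j * iteratedDeriv k (φ j) z := by
    intro C z hz k
    rw [iteratedDeriv_fun_add (hφ₀ z hz).contDiffAt (Finset.analyticAt_fun_sum _ fun j _ =>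
      analyticAt_const.fun_mul (hφ j z hz)).contDiffAt, iteratedDeriv_fun_sum fun j _ =>
      (analyticAt_const.fun_mul (hφ j z hz)).contDiffAt]
    simp only [iteratedDeriv_const_mul_field]
  have hlow : ∀ (C : Fin (s - r) → ℂ), ∀ k (hk : k < r),
      iteratedDeriv k (fun z => φ₀ z + ∑ j, C j * φ j z) c = x₀ ⟨k, hk⟩ := by
    intro C k hk
    rw [hder C c hc, hφ₀c k (by omega), dif_pos hk]
    simp only [hφc _ k (show k < s by omega)]
    rw [Finset.sum_eq_zero, add_zero]
    intro j _
    rw [if_neg (by omega), mul_zero]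
  have hhigh : ∀ (C : Fin (s - r) → ℂ) (i : Fin (s - r)),
      iteratedDeriv (r + i) (fun z => φ₀ z + ∑ j, C j * φ j z) c = C i := by
    intro C i
    have hi : r + (i : ℕ) < s := by omega
    rw [hder C c hc, hφ₀c _ hi, dif_neg (by omega), zero_add]
    simp only [hφc _ _ hi]
    rw [Finset.sum_eq_single i]
    · simp
    · intro j _ hj
      rw [if_neg, mul_zero]
      intro h; apply hj; ext; omega
    · simp
  have hode : ∀ C : Fin (s - r) → ℂ, ∀ z ∈ G, ∑ k ∈ Finset.range (s + 1),
      A k z * iteratedDeriv k (fun z => φ₀ z + ∑ j, C j * φ j z) z = f z := by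
    intro C z hz
    simp only [hder C z hz, mul_add, Finset.sum_add_distrib, hφ₀f z hz, Finset.mul_sum]
    rw [Finset.sum_comm, Finset.sum_eq_zero, add_zero]
    intro j _
    have : ∀ k, A k z * (C j * iteratedDeriv k (φ j) z) = C j * (A k z * iteratedDeriv k (φ j) z) :=
      fun k => by ring
    simp only [this]
    rw [← Finset.mul_sum, hφf j z hz, mul_zero]
  refine ⟨φ₀, φ, fun x => ⟨?_, ?_⟩, fun C C' h => ?_⟩
  · rintro ⟨hx, hxf, hxc⟩
    refine ⟨fun i => iteratedDeriv (r + i) x c, ?_⟩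
    refine eqOn_of_linear_ode hG hGs.isPathConnected.isConnected.isPreconnected hc hA (hs c hc) hx
      (han _) hxf (hode _) fun k hk => ?_
    rcases lt_or_ge k r with h | h
    · rw [hlow _ k h]; exact hxc ⟨k, h⟩
    · have := hhigh (fun i => iteratedDeriv (r + i) x c) ⟨k - r, by omega⟩
      simp only [Nat.add_sub_cancel' h] at this
      exact this.symm
  · rintro ⟨C, hC⟩
    -- Equality is known only on `G`, but `G` is open, so germs and derivatives at its points agree.
    have hev : ∀ z ∈ G, x =ᶠ[𝓝 z] fun z => φ₀ z + ∑ j, C j * φ j z := fun z hz =>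
      hC.eventuallyEq_of_mem (hG.mem_nhds hz)
    refine ⟨fun z hz => (han C z hz).congr (hev z hz).symm, fun z hz => ?_, fun v => ?_⟩
    · simp only [(hev z hz).iteratedDeriv_eq]
      exact hode C z hz
    · rw [(hev c hc).iteratedDeriv_eq, hlow C v v.2]
  · ext i
    rw [← hhigh C i, ← hhigh C' i]
    exact (h.eventuallyEq_of_mem (hG.mem_nhds hc)).iteratedDeriv_eq _

/-! ### The differential expression (B) in normal form -/

/-- The total coefficient of the derivative of order `j` in `odeOperator`. -/
noncomputable def totalCoefficient (p n m : ℕ) (a b : ℕ → ℂ → ℂ) (j : ℕ) (z : ℂ) : ℂ :=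
  (if j ≤ n then a j z else 0) +
    (if p - 1 ≤ j ∧ j ≤ m + p - 1 then b (j - (p - 1)) z / (Nat.factorial (p - 1) : ℂ) else 0)

theorem totalCoefficient_max {p : ℕ} (hp : 1 ≤ p) (n m : ℕ) (a b : ℕ → ℂ → ℂ) (z : ℂ) :
    totalCoefficient p n m a b (max n (m + p - 1)) z = leadingCoefficient p n m a b z := by
  unfold totalCoefficient leadingCoefficient
  congr 1
  · by_cases h : m + p - 1 ≤ n
    · simp [h]
    · rw [if_neg (by omega), if_neg h]
  · by_cases h : n ≤ m + p - 1
    · rw [if_pos (by omega), if_pos h, max_eq_right h, show m + p - 1 - (p - 1) = m by omega]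
    · rw [if_neg (by omega), if_neg h]

theorem odeOperator_eq_sum {p : ℕ} (hp : 1 ≤ p) (n m : ℕ) (a b : ℕ → ℂ → ℂ) (x : ℂ → ℂ) (z : ℂ) :
    odeOperator p n m a b x z = ∑ j ∈ Finset.range (max n (m + p - 1) + 1),
      totalCoefficient p n m a b j z * iteratedDeriv j x z := by
  unfold odeOperator totalCoefficient
  simp only [add_mul, Finset.sum_add_distrib, ite_mul, zero_mul]
  congr 1
  · rw [← Finset.sum_filter]
    refine Finset.sum_congr ?_ fun _ _ => rfl
    ext j; simp; omega
  · rw [← Finset.sum_filter]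
    -- The two maps are mutually inverse because `1 ≤ p` prevents truncation in `l + p - 1`.
    refine Finset.sum_bij' (fun l _ => l + p - 1) (fun j _ => j - (p - 1)) ?_ ?_ ?_ ?_ ?_
    · intro l hl; simp at hl ⊢; omega
    · intro l hl; simp at hl ⊢; omega
    · intro l hl; omega
    · intro l hl; simp at hl; omega
    · intro l hl; rw [show l + p - 1 - (p - 1) = l by omega]

theorem analyticOnNhd_totalCoefficient {G : Set ℂ} {p n m : ℕ} {a b : ℕ → ℂ → ℂ}
    (ha : ∀ k ≤ n, AnalyticOnNhd ℂ (a k) G) (hb : ∀ l ≤ m, AnalyticOnNhd ℂ (b l) G) (j : ℕ) :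
    AnalyticOnNhd ℂ (totalCoefficient p n m a b j) G := by
  intro z hz
  refine AnalyticAt.fun_add ?_ ?_
  · split_ifs with h
    · exact ha j h z hz
    · exact analyticAt_const
  · split_ifs with h
    · exact (hb _ (by omega) z hz).fun_div analyticAt_const (by exact_mod_cast Nat.factorial_ne_zero _)
    · exact analyticAt_const

/-! ### Parameter integrals and difference quotients -/

/-- Differentiation under the integral sign for integrands depending holomorphically on the
parameter. -/
theorem hasDerivAt_intervalIntegral_of_holomorphic {U : Set ℂ} (hU : IsOpen U) {F : ℂ → ℝ → ℂ}
    (hF : ContinuousOn (fun q : ℂ × ℝ => F q.1 q.2) (U ×ˢ univ))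
    (hd : ∀ u, DifferentiableOn ℂ (fun z => F z u) U) (a b : ℝ) {z₀ : ℂ} (hz₀ : z₀ ∈ U) :
    HasDerivAt (fun z => ∫ u in a..b, F z u) (∫ u in a..b, deriv (fun z => F z u) z₀) z₀ := by
  obtain ⟨R, hR, hRU⟩ := Metric.isOpen_iff.1 hU z₀ hz₀
  set r := R / 3 with hr
  have hr0 : 0 < r := by positivity
  have hsub : Metric.closedBall z₀ (2 * r) ⊆ U :=
    (Metric.closedBall_subset_ball (by linarith)).trans hRU
  have hFz : ∀ z ∈ U, Continuous (F z) := by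
    intro z hz
    have : ContinuousOn (fun u : ℝ => F z u) univ :=
      hF.comp (f := fun u : ℝ => (z, u)) (by fun_prop) (fun u _ => ⟨hz, mem_univ u⟩)
    exact continuousOn_univ.1 this
  have hK : IsCompact (Metric.closedBall z₀ (2 * r) ×ˢ uIcc a b) :=
    (isCompact_closedBall _ _).prod isCompact_uIcc
  obtain ⟨M, hM⟩ := hK.exists_bound_of_continuousOn (hF.mono (prod_mono hsub (subset_univ _)))
  -- The bound `M / r` is Cauchy's estimate on the circle of radius `r` about `z`, which stays in
  -- the disc of radius `2r` where `F` is bounded by `M`.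
  refine (intervalIntegral.hasDerivAt_integral_of_dominated_loc_of_deriv_le
    (F' := fun z u => deriv (fun z => F z u) z) (bound := fun _ => M / r)
    (Metric.ball_mem_nhds z₀ hr0) ?_ ((hFz z₀ hz₀).intervalIntegrable _ _) ?_ ?_
    (by simp) ?_).2
  · filter_upwards [hU.mem_nhds hz₀] with z hz
    exact (hFz z hz).aestronglyMeasurable
  -- Measurability in `u` of the derivative: it is the pointwise limit of difference quotients along
  -- the sequence `z₀ + r / (n + 1)`.
  · have hstep : Tendsto (fun n : ℕ => z₀ + ((r / (n + 1) : ℝ) : ℂ)) atTop (𝓝[≠] z₀) := by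
      rw [tendsto_nhdsWithin_iff]
      constructor
      · have h1 : Tendsto (fun n : ℕ => r / ((n : ℝ) + 1)) atTop (𝓝 0) :=
          tendsto_const_nhds.div_atTop (tendsto_natCast_atTop_atTop.atTop_add tendsto_const_nhds)
        have h2 := ((Complex.continuous_ofReal.tendsto 0).comp h1).const_add z₀
        simpa using h2
      · refine Eventually.of_forall fun n => ?_
        simp only [mem_compl_iff, mem_singleton_iff, add_eq_left, Complex.ofReal_eq_zero]
        positivity
    refine aestronglyMeasurable_of_tendsto_ae atTop
      (f := fun (n : ℕ) u => slope (fun z => F z u) z₀ (z₀ + ((r / (n + 1) : ℝ) : ℂ))) ?_ ?_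
    · intro n
      have hmem : z₀ + ((r / (n + 1) : ℝ) : ℂ) ∈ U := by
        apply hsub
        rw [mem_closedBall_iff_norm, add_sub_cancel_left, Complex.norm_real, Real.norm_eq_abs,
          abs_of_nonneg (by positivity)]
        exact (div_le_self hr0.le (by linarith [n.cast_nonneg (α := ℝ)])).trans (by linarith)
      simp only [slope_def_field]
      exact (((hFz _ hmem).sub (hFz z₀ hz₀)).div_const _).aestronglyMeasurable
    · refine Eventually.of_forall fun u => ?_
      exact ((hasDerivAt_iff_tendsto_slope.1
        ((hd u).differentiableAt (hU.mem_nhds hz₀)).hasDerivAt)).comp hstep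
  · refine Eventually.of_forall fun u hu z hz => ?_
    have hzs : Metric.closedBall z r ⊆ Metric.closedBall z₀ (2 * r) :=
      Metric.closedBall_subset_closedBall' (by rw [Metric.mem_ball] at hz; linarith)
    refine Complex.norm_deriv_le_of_forall_mem_sphere_norm_le hr0
      (((hd u).mono (hzs.trans hsub)).diffContOnCl_ball subset_rfl) fun w hw => ?_
    exact hM (w, u) ⟨hzs (Metric.sphere_subset_closedBall hw), uIoc_subset_uIcc hu⟩
  · refine Eventually.of_forall fun u _ z hz => ?_
    have hzU : z ∈ U := hsub (Metric.ball_subset_closedBall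
      (Metric.ball_subset_ball (by linarith) hz))
    exact ((hd u).differentiableAt (hU.mem_nhds hzU)).hasDerivAt

/-- Near the diagonal, strict differentiability at `w` controls the quotients with distinct
arguments, and continuity of the derivative controls the diagonal values. -/
theorem continuousAt_dslope_uncurry_diag {f : ℂ → ℂ} {w : ℂ} (hf : AnalyticAt ℂ f w) :
    ContinuousAt (fun q : ℂ × ℂ => dslope f q.1 q.2) (w, w) := by
  rw [Metric.continuousAt_iff']
  intro ε hε
  have h1 := hf.hasStrictDerivAt.hasStrictFDerivAt.isLittleO.bound (half_pos hε)
  have h2 : ∀ᶠ q : ℂ × ℂ in 𝓝 (w, w), dist (deriv f q.1) (deriv f w) < ε :=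
    (continuous_fst.tendsto (w, w)).eventually
      ((Metric.continuousAt_iff'.1 hf.deriv.continuousAt) ε hε)
  filter_upwards [h1, h2] with q hq1 hq2
  simp only [dslope_same]
  by_cases h : q.2 = q.1
  · rw [h, dslope_same]; exact hq2
  · rw [dslope_of_ne _ h, slope_comm, slope_def_field, dist_eq_norm]
    have hne : q.1 - q.2 ≠ 0 := sub_ne_zero.2 (Ne.symm h)
    have : (f q.1 - f q.2) / (q.1 - q.2) - deriv f w =
        (f q.1 - f q.2 - (q.1 - q.2) • deriv f w) / (q.1 - q.2) := by
      rw [smul_eq_mul]; field_simp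
    rw [this, norm_div, div_lt_iff₀ (norm_pos_iff.2 hne)]
    replace hq1 : ‖f q.1 - f q.2 - (q.1 - q.2) • deriv f w‖ ≤ ε / 2 * ‖q.1 - q.2‖ := by
      simpa using hq1
    refine hq1.trans_lt ?_
    have := norm_pos_iff.2 hne
    nlinarith

/-- The difference quotient of an analytic function is jointly continuous. -/
theorem continuousOn_dslope_uncurry {G : Set ℂ} {f : ℂ → ℂ}
    (hf : AnalyticOnNhd ℂ f G) :
    ContinuousOn (fun q : ℂ × ℂ => dslope f q.1 q.2) (G ×ˢ G) := by
  rintro ⟨w, z⟩ ⟨hw, hz⟩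
  apply ContinuousAt.continuousWithinAt
  rcases eq_or_ne z w with h | h
  · subst h; exact continuousAt_dslope_uncurry_diag (hf z hz)
  · have hne : ∀ᶠ q : ℂ × ℂ in 𝓝 (w, z), q.2 ≠ q.1 :=
      (isOpen_ne_fun continuous_snd continuous_fst).mem_nhds h
    have heq : (fun q : ℂ × ℂ => dslope f q.1 q.2) =ᶠ[𝓝 (w, z)]
        fun q => (f q.2 - f q.1) / (q.2 - q.1) := by
      filter_upwards [hne] with q hq
      rw [dslope_of_ne _ hq, slope_def_field]
    refine ContinuousAt.congr ?_ heq.symm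
    have h1 : ContinuousAt (fun q : ℂ × ℂ => f q.2) (w, z) :=
      ContinuousAt.comp (f := Prod.snd) (hf z hz).continuousAt continuousAt_snd
    have h2 : ContinuousAt (fun q : ℂ × ℂ => f q.1) (w, z) :=
      ContinuousAt.comp (f := Prod.fst) (hf w hw).continuousAt continuousAt_fst
    exact (h1.sub h2).div (by fun_prop) (sub_ne_zero.2 h)

/-! ### Winding integrals and Cauchy's theorem -/

section Contour

variable {γ : ℝ → ℂ}

theorem Function.Periodic.exists_norm_le (hper : Function.Periodic γ 1) (hγ : Continuous γ) :
    ∃ R, 0 < R ∧ ∀ u, ‖γ u‖ ≤ R := by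
  obtain ⟨R, hR⟩ := (hper.compact_of_continuous one_ne_zero hγ).isBounded.exists_pos_norm_le
  exact ⟨R, hR.1, fun u => hR.2 _ (mem_range_self u)⟩

/-- Integrals of Cauchy type vanish at infinity. -/
theorem tendsto_cauchyIntegral_cocompact (hper : Function.Periodic γ 1) (hγ : Continuous γ)
    {g : ℝ → ℂ} (hg : Continuous g) :
    Tendsto (fun z => ∫ u in (0 : ℝ)..1, g u / (γ u - z)) (cocompact ℂ) (𝓝 0) := by
  obtain ⟨R, hR, hγR⟩ := hper.exists_norm_le hγ
  obtain ⟨M, hM⟩ := (isCompact_uIcc (a := (0 : ℝ)) (b := 1)).exists_bound_of_continuousOn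
    hg.continuousOn
  have hM0 : 0 ≤ M := (norm_nonneg _).trans (hM 0 (by simp))
  have hlim : Tendsto (fun z : ℂ => M / (‖z‖ - R)) (cocompact ℂ) (𝓝 0) :=
    tendsto_const_nhds.div_atTop
      (tendsto_atTop_add_const_right _ _ (tendsto_norm_cocompact_atTop (E := ℂ)))
  refine squeeze_zero_norm' ?_ hlim
  filter_upwards [(tendsto_norm_cocompact_atTop (E := ℂ)).eventually_gt_atTop R] with z hz
  refine (intervalIntegral.norm_integral_le_of_norm_le_const (C := M / (‖z‖ - R))
    fun u hu => ?_).trans (by simp)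
  rw [norm_div]
  have h1 : ‖z‖ - R ≤ ‖γ u - z‖ := by
    have := norm_sub_norm_le z (γ u)
    rw [norm_sub_rev] at this
    linarith [hγR u]
  have := hM u (uIoc_subset_uIcc hu)
  gcongr

/-- A Cauchy type integral along `γ` is holomorphic off the contour. -/
theorem hasDerivAt_cauchyIntegral (hper : Function.Periodic γ 1) (hγ : Continuous γ)
    {g : ℝ → ℂ} (hg : Continuous g) {z : ℂ} (hz : z ∉ range γ) :
    HasDerivAt (fun z => ∫ u in (0 : ℝ)..1, g u / (γ u - z))
      (∫ u in (0 : ℝ)..1, g u / (γ u - z) ^ 2) z := by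
  have hU : IsOpen (range γ)ᶜ := (hper.compact_of_continuous one_ne_zero hγ).isClosed.isOpen_compl
  have hne : ∀ w ∈ (range γ)ᶜ, ∀ u, γ u - w ≠ 0 := fun w hw u h =>
    hw ⟨u, sub_eq_zero.1 h⟩
  have hd : ∀ w ∈ (range γ)ᶜ, ∀ u, HasDerivAt (fun z => g u / (γ u - z)) (g u / (γ u - w) ^ 2) w := by
    intro w hw u
    have h1 : HasDerivAt (fun z => γ u - z) (-1) w := by
      simpa using (hasDerivAt_id w).const_sub (γ u)
    refine ((hasDerivAt_const w (g u)).fun_div h1 (hne w hw u)).congr_deriv ?_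
    simp
  have := hasDerivAt_intervalIntegral_of_holomorphic hU (F := fun z u => g u / (γ u - z)) ?_
    (fun u w hw => (hd w hw u).differentiableAt.differentiableWithinAt) 0 1 hz
  · simpa only [(hd z hz _).deriv] using this
  · refine ContinuousOn.div (by fun_prop) (by fun_prop) ?_
    rintro ⟨w, u⟩ ⟨hw, -⟩
    exact hne w hw u

/-- The points which are neither on the contour nor inner form an open set. -/
theorem isOpen_compl_contour_union_innerDomain (hper : Function.Periodic γ 1) (hγ : Continuous γ) :
    IsOpen (range γ ∪ innerDomain γ)ᶜ := by
  have hU : IsOpen (range γ)ᶜ := (hper.compact_of_continuous one_ne_zero hγ).isClosed.isOpen_compl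
  rw [isOpen_iff_mem_nhds]
  intro z hz
  rw [compl_union] at hz
  filter_upwards [(hU.connectedComponentIn (x := z)).mem_nhds (mem_connectedComponentIn hz.1)]
    with w hw
  rw [compl_union]
  refine ⟨connectedComponentIn_subset _ _ hw, fun h => hz.2 ⟨hz.1, ?_⟩⟩
  rw [connectedComponentIn_eq hw]
  exact h.2

/-- Beyond a disc containing the contour, the outward radial ray through `z` is connected, unbounded
and misses the contour, so the component of `z` is unbounded. -/
theorem eventually_cocompact_notMem_contour_union_innerDomain (hper : Function.Periodic γ 1)
    (hγ : Continuous γ) : ∀ᶠ z in cocompact ℂ, z ∉ range γ ∪ innerDomain γ := by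
  obtain ⟨R, hR, hγR⟩ := hper.exists_norm_le hγ
  filter_upwards [(tendsto_norm_cocompact_atTop (E := ℂ)).eventually_gt_atTop R] with z hz
  have hray : (fun t : ℝ => (t : ℂ) * z) '' Ici 1 ⊆ (range γ)ᶜ := by
    rintro _ ⟨t, ht, rfl⟩ ⟨u, hu⟩
    have := hγR u
    rw [hu, norm_mul, Complex.norm_real, Real.norm_eq_abs] at this
    have h1 : 1 ≤ |t| := le_trans ht (le_abs_self t)
    nlinarith [norm_nonneg z]
  have hz1 : z ∈ (fun t : ℝ => (t : ℂ) * z) '' Ici 1 := ⟨1, by simp, by simp⟩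
  rintro (h | ⟨-, h⟩)
  · exact hray hz1 h
  · have hpre : IsPreconnected ((fun t : ℝ => (t : ℂ) * z) '' Ici 1) :=
      isPreconnected_Ici.image _ (by fun_prop)
    obtain ⟨C, hC⟩ := (h.subset (hpre.subset_connectedComponentIn hz1 hray)).exists_norm_le
    have hz0 : 0 < ‖z‖ := hR.trans hz
    have := hC _ ⟨max 1 ((C + 1) / ‖z‖), by simp, rfl⟩
    rw [norm_mul, Complex.norm_real, Real.norm_eq_abs] at this
    have h2 : (C + 1) / ‖z‖ ≤ |max 1 ((C + 1) / ‖z‖)| := (le_max_right _ _).trans (le_abs_self _)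
    rw [div_le_iff₀ hz0] at h2
    linarith

/-- The contour does not wind around points which are neither on it nor inner. -/
theorem windingIntegral_eq_zero (hper : Function.Periodic γ 1) (hγ : ContDiff ℝ 1 γ)
    {z : ℂ} (hz : z ∉ range γ ∪ innerDomain γ) :
    ∫ u in (0 : ℝ)..1, deriv γ u / (γ u - z) = 0 := by
  have hc := hγ.continuous
  have hg : Continuous (deriv γ) := hγ.continuous_deriv le_rfl
  have hU : IsOpen (range γ)ᶜ := (hper.compact_of_continuous one_ne_zero hc).isClosed.isOpen_compl
  rw [mem_union, not_or] at hz
  set C := connectedComponentIn (range γ)ᶜ z with hC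
  have hzC : z ∈ C := mem_connectedComponentIn hz.1
  have hCsub : C ⊆ (range γ)ᶜ := connectedComponentIn_subset _ _
  have hunb : ¬ Bornology.IsBounded C := fun h => hz.2 ⟨hz.1, h⟩
  -- The derivative of the winding integral integrates an exact derivative over a full period, hence
  -- is zero.
  have hder : ∀ w ∈ C, HasDerivAt (fun z => ∫ u in (0 : ℝ)..1, deriv γ u / (γ u - z)) 0 w := by
    intro w hw
    have hne : ∀ u, γ u - w ≠ 0 := fun u h => hCsub hw ⟨u, sub_eq_zero.1 h⟩
    convert hasDerivAt_cauchyIntegral hper hc hg (hCsub hw) using 1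
    have : ∀ u ∈ uIcc (0 : ℝ) 1, HasDerivAt (fun u => -(γ u - w)⁻¹) (deriv γ u / (γ u - w) ^ 2) u := by
      intro u _
      have h1 : HasDerivAt (fun u => γ u - w) (deriv γ u) u :=
        ((hγ.differentiable one_ne_zero u).hasDerivAt).sub_const w
      refine (h1.fun_inv (hne u)).fun_neg.congr_deriv ?_
      ring
    rw [intervalIntegral.integral_eq_sub_of_hasDerivAt this]
    · have := hper 0
      rw [zero_add] at this
      rw [this]; ring
    · refine Continuous.intervalIntegrable (hg.div (by fun_prop) fun u => pow_ne_zero _ (hne u)) _ _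
  have hconst : ∀ w ∈ C, ∫ u in (0 : ℝ)..1, deriv γ u / (γ u - w) =
      ∫ u in (0 : ℝ)..1, deriv γ u / (γ u - z) := fun w hw =>
    (hU.connectedComponentIn (x := z)).is_const_of_deriv_eq_zero
      isPreconnected_connectedComponentIn
      (fun v hv => (hder v hv).differentiableAt.differentiableWithinAt)
      (fun v hv => (hder v hv).deriv) hw hzC
  -- The integral is constant on `C` and tends to zero at infinity; a nonzero constant would force
  -- `C` to be bounded.
  by_contra hne
  have hev := (tendsto_cauchyIntegral_cocompact hper hc hg).eventually_ne (Ne.symm hne)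
  rw [Metric.cobounded_eq_cocompact.symm] at hev
  apply hunb
  rw [← Bornology.isCobounded_compl_iff]
  filter_upwards [hev] with w hw hwC
  exact hw (hconst w hwC)

/-- **Cauchy's theorem** for the difference quotients of an analytic function. -/
theorem integral_dslope_eq_zero (hper : Function.Periodic γ 1) (hγ : ContDiff ℝ 1 γ) {G : Set ℂ}
    (hG : IsOpen G) (hsub : range γ ∪ innerDomain γ ⊆ G) {f : ℂ → ℂ} (hf : AnalyticOnNhd ℂ f G)
    {w : ℂ} (hw : w ∈ G) : ∫ u in (0 : ℝ)..1, dslope f w (γ u) * deriv γ u = 0 := by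
  classical
  have hc := hγ.continuous
  have hg : Continuous (deriv γ) := hγ.continuous_deriv le_rfl
  have hγG : ∀ u, γ u ∈ G := fun u => hsub (Or.inl (mem_range_self u))
  have hfγ : Continuous fun u => f (γ u) :=
    (hf.continuousOn.comp_continuous hc hγG)
  have hdsc := continuousOn_dslope_uncurry hf
  have hcomm : ∀ z u, dslope f z (γ u) = dslope f (γ u) z := by
    intro z u
    rcases eq_or_ne z (γ u) with h | h
    · rw [h]
    · rw [dslope_of_ne _ h, dslope_of_ne _ h.symm, slope_comm]
  let O : Set ℂ := (range γ ∪ innerDomain γ)ᶜ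
  have hO : IsOpen O := isOpen_compl_contour_union_innerDomain hper hc
  let h₁ : ℂ → ℂ := fun z => ∫ u in (0 : ℝ)..1, dslope f z (γ u) * deriv γ u
  let h₂ : ℂ → ℂ := fun z => ∫ u in (0 : ℝ)..1, f (γ u) * deriv γ u / (γ u - z)
  -- Dixon's argument: on `G ∩ O` the two definitions agree because the winding integral vanishes on
  -- `O`. As `G` and `O` cover the plane, `h` is entire; it tends to zero at infinity, so it
  -- vanishes by Liouville's theorem.
  let h : ℂ → ℂ := fun z => if z ∈ G then h₁ z else h₂ z
  have hagree : ∀ z ∈ O, h z = h₂ z := by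
    intro z hz
    by_cases hzG : z ∈ G
    · simp only [h, if_pos hzG, h₁, h₂]
      have hne : ∀ u, γ u - z ≠ 0 := fun u h => hz (Or.inl ⟨u, sub_eq_zero.1 h⟩)
      have h0 := windingIntegral_eq_zero hper hγ hz
      have : ∀ u, dslope f z (γ u) * deriv γ u =
          f (γ u) * deriv γ u / (γ u - z) - f z * (deriv γ u / (γ u - z)) := by
        intro u
        rw [dslope_of_ne _ (sub_ne_zero.1 (hne u)), slope_def_field]
        ring
      simp only [this]
      rw [intervalIntegral.integral_sub, intervalIntegral.integral_const_mul, h0, mul_zero, sub_zero]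
      · exact ((hfγ.mul hg).div (by fun_prop) hne).intervalIntegrable _ _
      · exact (continuous_const.mul (hg.div (by fun_prop) hne)).intervalIntegrable _ _
    · simp [h, hzG]
  have hdiff : Differentiable ℂ h := by
    intro z
    by_cases hzG : z ∈ G
    · have : h =ᶠ[𝓝 z] h₁ := by
        filter_upwards [hG.mem_nhds hzG] with v hv
        simp [h, hv]
      refine DifferentiableAt.congr_of_eventuallyEq ?_ this
      refine (hasDerivAt_intervalIntegral_of_holomorphic hG
        (F := fun z u => dslope f z (γ u) * deriv γ u) ?_ ?_ 0 1 hzG).differentiableAt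
      · refine ContinuousOn.mul ?_ (by fun_prop)
        exact hdsc.comp (f := fun q : ℂ × ℝ => (q.1, γ q.2)) (by fun_prop)
          (fun q hq => ⟨hq.1, hγG _⟩)
      · intro u
        simp only [hcomm]
        exact ((Complex.differentiableOn_dslope (hG.mem_nhds (hγG u))).2
          hf.differentiableOn).mul_const _
    · have hzO : z ∈ O := fun hz => hzG (hsub hz)
      have : h =ᶠ[𝓝 z] h₂ := by
        filter_upwards [hO.mem_nhds hzO] with v hv using hagree v hv
      refine DifferentiableAt.congr_of_eventuallyEq ?_ this
      exact (hasDerivAt_cauchyIntegral hper hc (hfγ.mul hg)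
        fun hz => hzO (Or.inl hz)).differentiableAt
  have hlim : Tendsto h (cocompact ℂ) (𝓝 0) := by
    refine (tendsto_cauchyIntegral_cocompact hper hc (hfγ.mul hg)).congr' ?_
    filter_upwards [eventually_cocompact_notMem_contour_union_innerDomain hper hc] with z hz
    exact (hagree z hz).symm
  have := hdiff.apply_eq_of_tendsto_cocompact w hlim
  simpa [h, hw, h₁] using this

end Contour

/-! ### Truncated integrals and change of base point -/

section Contour

variable {γ : ℝ → ℂ}

theorem Function.Periodic.deriv_of_periodic {c : ℝ} (hper : Function.Periodic γ c) :
    Function.Periodic (deriv γ) c := by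
  intro u
  rw [← deriv_comp_add_const]
  congr 1
  exact funext hper

theorem truncatedIntegral_eq_indicator (hγ : Continuous γ) (p : ℕ) (φ : ℂ → ℂ) (t : ℂ) (v : ℝ) :
    truncatedIntegral γ p φ t v = ∫ u in (0 : ℝ)..1,
      {u | v < ‖γ u - t‖}.indicator (fun u => φ (γ u) / (γ u - t) ^ p * deriv γ u) u := by
  have hm : MeasurableSet {u | v < ‖γ u - t‖} :=
    (isOpen_lt continuous_const (by fun_prop)).measurableSet
  rw [intervalIntegral.integral_of_le zero_le_one, MeasureTheory.setIntegral_indicator hm]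
  rfl

theorem periodic_truncatedIntegrand (hper : Function.Periodic γ 1) (p : ℕ) (φ : ℂ → ℂ) (t : ℂ)
    (v : ℝ) : Function.Periodic ({u | v < ‖γ u - t‖}.indicator
      (fun u => φ (γ u) / (γ u - t) ^ p * deriv γ u)) 1 := by
  intro u
  simp only [indicator, mem_ofPred_eq, hper u, hper.deriv_of_periodic u]

/-- Over this period the singular parameter `u = 0` of the point `γ 0` is interior. -/
theorem truncatedIntegral_eq_symm_interval (hper : Function.Periodic γ 1) (hγ : Continuous γ)
    (p : ℕ) (φ : ℂ → ℂ) (t : ℂ) (v : ℝ) :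
    truncatedIntegral γ p φ t v = ∫ u in (-(1 / 2) : ℝ)..1 / 2,
      {u | v < ‖γ u - t‖}.indicator (fun u => φ (γ u) / (γ u - t) ^ p * deriv γ u) u := by
  rw [truncatedIntegral_eq_indicator hγ]
  have := (periodic_truncatedIntegrand hper p φ t v).intervalIntegral_add_eq 0 (-(1 / 2))
  norm_num at this ⊢
  exact this

/-- This and the shifts of the contour data below allow any point of the contour to be taken as `γ
0`. -/
theorem truncatedIntegral_shift (hper : Function.Periodic γ 1) (hγ : Continuous γ) (u₀ : ℝ)
    (p : ℕ) (φ : ℂ → ℂ) (t : ℂ) (v : ℝ) :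
    truncatedIntegral (fun u => γ (u₀ + u)) p φ t v = truncatedIntegral γ p φ t v := by
  rw [truncatedIntegral_eq_indicator hγ,
    truncatedIntegral_eq_indicator (γ := fun u => γ (u₀ + u)) (by fun_prop)]
  have h1 := (periodic_truncatedIntegrand hper p φ t v).intervalIntegral_add_eq u₀ 0
  rw [zero_add] at h1
  rw [← h1]
  have h2 := intervalIntegral.integral_comp_add_left (a := 0) (b := 1)
    ({u | v < ‖γ u - t‖}.indicator (fun u => φ (γ u) / (γ u - t) ^ p * deriv γ u)) u₀
  rw [add_zero] at h2
  rw [← h2]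
  simp only [indicator, mem_ofPred_eq, deriv_comp_const_add]

theorem range_shift (γ : ℝ → ℂ) (u₀ : ℝ) : range (fun u => γ (u₀ + u)) = range γ :=
  (Equiv.addLeft u₀).surjective.range_comp γ

theorem IsSmoothClosedContour.shift {q : ℕ} (h : IsSmoothClosedContour q γ) (u₀ : ℝ) :
    IsSmoothClosedContour q (fun u => γ (u₀ + u)) where
  periodic := fun u => by
    simp only [← add_assoc]; exact h.periodic _
  contDiff := h.contDiff.comp (contDiff_const.add contDiff_id)
  deriv_ne_zero := fun u => by
    rw [deriv_comp_const_add]; exact h.deriv_ne_zero _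
  injOn := by
    intro u hu v hv huv
    have key : ∀ x, γ (Int.fract x) = γ x := fun x => by
      have := h.periodic.sub_int_mul_eq (x := x) ⌊x⌋
      rwa [mul_one] at this
    have h1 : Int.fract (u₀ + u) = Int.fract (u₀ + v) :=
      h.injOn ⟨Int.fract_nonneg _, Int.fract_lt_one _⟩ ⟨Int.fract_nonneg _, Int.fract_lt_one _⟩
        (by rw [key, key]; exact huv)
    obtain ⟨k, hk⟩ := Int.fract_eq_fract.1 h1
    have h2 : u - v = k := by linarith
    have h3 : (-1 : ℝ) < k ∧ (k : ℝ) < 1 := by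
      constructor <;> linarith [hu.1, hu.2, hv.1, hv.2]
    have h4 : k = 0 := by
      have h5 : -1 < k := by exact_mod_cast h3.1
      have h6 : k < 1 := by exact_mod_cast h3.2
      omega
    rw [h4] at h2
    simp at h2
    linarith

theorem IsPositivelyOriented.shift (hper : Function.Periodic γ 1) (h : IsPositivelyOriented γ)
    (u₀ : ℝ) : IsPositivelyOriented (fun u => γ (u₀ + u)) := by
  intro z hz
  rw [innerDomain, range_shift] at hz
  rw [← h z hz]
  simp only [deriv_comp_const_add]
  have hp : Function.Periodic (fun u => deriv γ u / (γ u - z)) 1 := fun u => by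
    simp only [hper u, hper.deriv_of_periodic u]
  have h1 := hp.intervalIntegral_add_eq u₀ 0
  rw [zero_add] at h1
  rw [← h1]
  have h2 := intervalIntegral.integral_comp_add_left (a := 0) (b := 1)
    (fun u => deriv γ u / (γ u - z)) u₀
  rw [add_zero] at h2
  exact h2

theorem IsSmoothClosedContour.ne_of_mem {q : ℕ} (h : IsSmoothClosedContour q γ) {u : ℝ}
    (hu : u ≠ 0) (hu' : u ∈ Icc (-(1 / 2) : ℝ) (1 / 2)) : γ u ≠ γ 0 := by
  intro heq
  rcases lt_or_gt_of_ne hu with h0 | h0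
  · have h1 := h.injOn (show u + 1 ∈ Ico (0 : ℝ) 1 by constructor <;> linarith [hu'.1])
      (show (0 : ℝ) ∈ Ico (0 : ℝ) 1 by simp) (by rw [h.periodic u, heq])
    linarith [hu'.1]
  · exact hu (h.injOn ⟨h0.le, by linarith [hu'.2]⟩ (by simp) heq)

/-- On a bounded interval the truncation set lies in a compact set that avoids the singularity, and
`h` is continuous there. -/
theorem intervalIntegrable_truncated (hγ : Continuous γ) {t : ℂ} {h : ℝ → ℂ}
    (hh : ContinuousOn h {u | γ u ≠ t}) {v : ℝ} (hv : 0 < v) (a b : ℝ) :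
    IntervalIntegrable ({u | v < ‖γ u - t‖}.indicator h) MeasureTheory.volume a b := by
  have hm : MeasurableSet {u | v < ‖γ u - t‖} :=
    (isOpen_lt continuous_const (by fun_prop)).measurableSet
  have hcl : IsClosed {u | v ≤ ‖γ u - t‖} := isClosed_le continuous_const (by fun_prop)
  rw [intervalIntegrable_iff, MeasureTheory.IntegrableOn,
    MeasureTheory.integrable_indicator_iff hm, MeasureTheory.IntegrableOn,
    MeasureTheory.Measure.restrict_restrict hm]
  have hcomp : IsCompact ({u | v ≤ ‖γ u - t‖} ∩ uIcc a b) := isCompact_uIcc.inter_left hcl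
  refine MeasureTheory.IntegrableOn.mono_set ((hh.mono ?_).integrableOn_compact hcomp)
    (inter_subset_inter (fun u (hu : v < _) => hu.le) uIoc_subset_uIcc)
  rintro u ⟨hu, -⟩ heq
  rw [mem_ofPred_eq, heq, sub_self, norm_zero] at hu
  linarith

end Contour

/-! ### Boundary behaviour of the Cauchy integral along the normal -/

/-- Dominated convergence after rescaling the variable around the origin. -/
theorem tendsto_integral_of_rescaled {k : ℝ → ℝ → ℂ} {k₀ : ℝ → ℂ} {K : ℝ} (hK : 0 ≤ K)
    (hm : ∀ ε, Measurable (k ε))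
    (hb : ∀ᶠ ε : ℝ in 𝓝[>] 0, ∀ w : ℝ, |ε * w| ≤ 1 / 2 →
      ‖(ε : ℂ) * k ε (ε * w)‖ ≤ K * (1 + w ^ 2)⁻¹)
    (hl : ∀ᵐ w : ℝ, Tendsto (fun ε : ℝ => (ε : ℂ) * k ε (ε * w)) (𝓝[>] 0) (𝓝 (k₀ w))) :
    Tendsto (fun ε => ∫ u in (-(1 / 2) : ℝ)..1 / 2, k ε u) (𝓝[>] 0) (𝓝 (∫ w, k₀ w)) := by
  -- Substitution `u = εw`; the indicator records the rescaled interval of integration.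
  have heq : (fun ε : ℝ => ∫ w, (Ioc (-(1 / 2) / ε) (1 / 2 / ε)).indicator
      (fun w => (ε : ℂ) * k ε (ε * w)) w) =ᶠ[𝓝[>] 0]
      fun ε => ∫ u in (-(1 / 2) : ℝ)..1 / 2, k ε u := by
    filter_upwards [self_mem_nhdsWithin] with ε (hε : 0 < ε)
    have h1 : -(1 / 2) / ε ≤ 1 / 2 / ε := by gcongr; norm_num
    rw [MeasureTheory.integral_indicator measurableSet_Ioc, ← intervalIntegral.integral_of_le h1,
      intervalIntegral.integral_const_mul]
    have := intervalIntegral.smul_integral_comp_mul_left (a := -(1 / 2) / ε) (b := 1 / 2 / ε)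
      (k ε) ε
    rw [mul_div_cancel₀ _ hε.ne', mul_div_cancel₀ _ hε.ne'] at this
    rw [← this, Complex.real_smul]
  refine Tendsto.congr' heq ?_
  refine MeasureTheory.tendsto_integral_filter_of_dominated_convergence
    (fun w => K * (1 + w ^ 2)⁻¹) ?_ ?_ (integrable_inv_one_add_sq.const_mul K) ?_
  · refine Eventually.of_forall fun ε => ?_
    exact (((hm ε).comp (measurable_const_mul ε)).const_mul _).aestronglyMeasurable.indicator
      measurableSet_Ioc
  · filter_upwards [hb, self_mem_nhdsWithin] with ε h (hε : 0 < ε)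
    refine Eventually.of_forall fun w => ?_
    by_cases hw : w ∈ Ioc (-(1 / 2) / ε) (1 / 2 / ε)
    · rw [indicator_of_mem hw]
      apply h
      rw [abs_le]
      have h1 := (div_lt_iff₀ hε).1 hw.1
      have h2 := (le_div_iff₀ hε).1 hw.2
      constructor <;> linarith
    · rw [indicator_of_notMem hw, norm_zero]
      positivity
  · filter_upwards [hl] with w hw
    refine hw.congr' ?_
    have h1 : Tendsto (fun ε : ℝ => ε * w) (𝓝[>] 0) (𝓝 0) := by
      have : Tendsto (fun ε : ℝ => ε * w) (𝓝 0) (𝓝 (0 * w)) :=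
        (continuous_mul_const w).tendsto 0
      rw [zero_mul] at this
      exact this.mono_left nhdsWithin_le_nhds
    filter_upwards [self_mem_nhdsWithin, h1.eventually (Ioo_mem_nhds (show (-(1 / 2) : ℝ) < 0 by norm_num)
      (show (0 : ℝ) < 1 / 2 by norm_num))] with ε (hε : 0 < ε) hw'
    rw [indicator_of_mem]
    constructor
    · rw [div_lt_iff₀ hε]; linarith [hw'.1]
    · rw [le_div_iff₀ hε]; linarith [hw'.2]

section Contour

variable {γ : ℝ → ℂ}

/-- Near `γ 0` the distance from the points of the normal to the contour is bounded below. -/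
theorem IsSmoothClosedContour.exists_lower_bound (h : IsSmoothClosedContour 1 γ) :
    ∃ c > 0, ∃ ε₀ > 0, ∀ b : ℝ, |b| < ε₀ → ∀ u : ℝ, |u| ≤ 1 / 2 →
      c * (|u| + |b|) ≤ ‖γ u - γ 0 - b * (Complex.I * deriv γ 0)‖ := by
  set T := deriv γ 0 with hT
  have hT0 : 0 < ‖T‖ := norm_pos_iff.2 (h.deriv_ne_zero 0)
  have hc : Continuous γ := h.contDiff.continuous
  have hd : HasDerivAt γ T 0 := (h.contDiff.differentiable one_ne_zero 0).hasDerivAt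
  have h1 := (hasDerivAt_iff_isLittleO.1 hd).bound (show 0 < ‖T‖ / 4 by positivity)
  obtain ⟨δ, hδ, hδ'⟩ := Metric.eventually_nhds_iff.1 h1
  have hK : IsCompact (Icc (-(1 / 2) : ℝ) (1 / 2) ∩ {u | δ ≤ |u|}) :=
    isCompact_Icc.inter_right (isClosed_le continuous_const continuous_abs)
  obtain ⟨d, hd0, hd'⟩ := hK.exists_forall_le' (f := fun u => ‖γ u - γ 0‖) (a := 0)
    (by fun_prop) (by
      rintro u ⟨hu, hu'⟩
      refine norm_pos_iff.2 (sub_ne_zero.2 (h.ne_of_mem ?_ hu))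
      rintro rfl
      simp at hu'
      linarith)
  -- For `|u| < δ`: `|u - ib| ≥ (|u| + |b|) / 2`, and linearizing `γ` costs at most `‖T‖ |u| / 4`,
  -- which leaves `‖T‖ / 4`. For `|u| ≥ δ`: the distance to `γ 0` is at least `d`, the normal shift
  -- is at most `d / 2`, and `|u| + |b| ≤ 1`.
  refine ⟨min (‖T‖ / 4) (d / 2), by positivity, min (1 / 2) (d / (2 * ‖T‖)), by positivity, ?_⟩
  intro b hb u hu
  have hb1 : |b| ≤ 1 / 2 := (hb.trans_le (min_le_left _ _)).le
  have hb2 : |b| * ‖T‖ ≤ d / 2 := by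
    have := (hb.trans_le (min_le_right _ _)).le
    rw [le_div_iff₀ (by positivity)] at this
    linarith
  have hsum : 0 ≤ |u| + |b| := by positivity
  rcases lt_or_ge |u| δ with hlt | hge
  · have h2 := hδ' (show dist u 0 < δ by simpa using hlt)
    simp only [sub_zero, Complex.real_smul, Real.norm_eq_abs] at h2
    have h3 : (|u| + |b|) / 2 ≤ ‖(u : ℂ) - b * Complex.I‖ := by
      have h4 := Complex.abs_re_le_norm ((u : ℂ) - b * Complex.I)
      have h5 := Complex.abs_im_le_norm ((u : ℂ) - b * Complex.I)
      simp at h4 h5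
      linarith
    have h6 : ‖((u : ℂ) - b * Complex.I) * T‖ ≤
        ‖γ u - γ 0 - b * (Complex.I * T)‖ + ‖γ u - γ 0 - u * T‖ := by
      have := norm_sub_le (γ u - γ 0 - b * (Complex.I * T)) (γ u - γ 0 - u * T)
      rwa [show γ u - γ 0 - b * (Complex.I * T) - (γ u - γ 0 - u * T) =
        ((u : ℂ) - b * Complex.I) * T by ring] at this
    rw [norm_mul] at h6
    have h7 : (|u| + |b|) / 2 * ‖T‖ ≤ ‖(u : ℂ) - b * Complex.I‖ * ‖T‖ := by gcongr
    calc _ ≤ ‖T‖ / 4 * (|u| + |b|) := by gcongr; exact min_le_left _ _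
      _ ≤ _ := by nlinarith [abs_nonneg u, abs_nonneg b]
  · have h2 := hd' u ⟨abs_le.1 hu, hge⟩
    have h3 := norm_sub_norm_le (γ u - γ 0) (b * (Complex.I * T))
    have h4 : ‖(b : ℂ) * (Complex.I * T)‖ = |b| * ‖T‖ := by simp
    rw [h4] at h3
    calc _ ≤ d / 2 * (|u| + |b|) := by gcongr; exact min_le_right _ _
      _ ≤ d / 2 * 1 := by gcongr; linarith
      _ ≤ _ := by linarith

theorem tendsto_rescaled_contour {T : ℂ} (hd : HasDerivAt γ T 0) (w : ℝ) :
    Tendsto (fun ε : ℝ => (γ (ε * w) - γ 0) / ε) (𝓝[>] 0) (𝓝 (w * T)) := by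
  have h1 : HasDerivAt (fun ε : ℝ => γ (ε * w)) (w * T) 0 := by
    have h2 : HasDerivAt (fun ε : ℝ => ε * w) w 0 := by
      simpa using (hasDerivAt_id (0 : ℝ)).mul_const w
    have h3 : HasDerivAt γ T ((0 : ℝ) * w) := by simpa using hd
    rw [← Complex.real_smul]
    exact h3.scomp (0 : ℝ) h2
  have h4 := (hasDerivAt_iff_tendsto_slope.1 h1).mono_left
    (nhdsWithin_mono (0 : ℝ) (fun x (hx : 0 < x) => (ne_of_gt hx : x ≠ 0)))
  refine h4.congr fun ε => ?_
  rw [slope_def_module]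
  simp [div_eq_inv_mul]

end Contour

section Contour

variable {γ : ℝ → ℂ}

/-- Under rescaling the contour becomes its tangent line and the kernel becomes `1 / (w - b)`. The
values `b = ±i` are the two points of the normal, and `b = 0` is the point of the contour itself. -/
theorem rescaled_tendsto_cauchyKernel (h : IsSmoothClosedContour 1 γ) (w : ℝ) {b : ℂ}
    (hb : (w : ℂ) - b ≠ 0) :
    Tendsto (fun ε : ℝ => (ε : ℂ) * (deriv γ (ε * w) /
      (γ (ε * w) - γ 0 - ε * (b * deriv γ 0)))) (𝓝[>] 0) (𝓝 (1 / (w - b))) := by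
  have hT : deriv γ 0 ≠ 0 := h.deriv_ne_zero 0
  have hd : HasDerivAt γ (deriv γ 0) 0 := (h.contDiff.differentiable one_ne_zero 0).hasDerivAt
  have hA := tendsto_rescaled_contour hd w
  have hg : Continuous (deriv γ) := h.contDiff.continuous_deriv le_rfl
  have h1 : Tendsto (fun ε : ℝ => deriv γ (ε * w)) (𝓝[>] 0) (𝓝 (deriv γ 0)) := by
    have : Tendsto (fun ε : ℝ => deriv γ (ε * w)) (𝓝 0) (𝓝 (deriv γ (0 * w))) :=
      (hg.comp (continuous_mul_const w)).tendsto 0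
    rw [zero_mul] at this
    exact this.mono_left nhdsWithin_le_nhds
  have h2 : (w : ℂ) * deriv γ 0 - b * deriv γ 0 ≠ 0 := by
    rw [← sub_mul]; exact mul_ne_zero hb hT
  have h3 := h1.div (hA.sub_const (b * deriv γ 0)) h2
  have h4 : deriv γ 0 / ((w : ℂ) * deriv γ 0 - b * deriv γ 0) = 1 / (w - b) := by
    rw [← sub_mul]; field_simp
  rw [h4] at h3
  refine h3.congr' ?_
  filter_upwards [self_mem_nhdsWithin] with ε (hε : 0 < ε)
  have hε' : (ε : ℂ) ≠ 0 := by exact_mod_cast hε.ne'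
  have : (γ (ε * w) - γ 0) / ε - b * deriv γ 0 =
      (γ (ε * w) - γ 0 - ε * (b * deriv γ 0)) / ε := by field_simp
  simp only [Pi.div_apply, this]
  rw [div_div_eq_mul_div, mul_comm, mul_div_assoc]

theorem ofReal_sub_I_ne_zero (w : ℝ) : (w : ℂ) - Complex.I ≠ 0 := by
  intro h; simpa using congrArg Complex.im h

theorem ofReal_add_I_ne_zero (w : ℝ) : (w : ℂ) - -Complex.I ≠ 0 := by
  intro h; simpa using congrArg Complex.im h

/-- Bounds for the contour in the rescaled variable. -/
theorem IsSmoothClosedContour.exists_rescaled_bound (h : IsSmoothClosedContour 1 γ) :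
    ∃ c > 0, ∃ M, 0 ≤ M ∧ ∀ᶠ ε : ℝ in 𝓝[>] 0, 0 < ε ∧ ∀ w : ℝ, |ε * w| ≤ 1 / 2 →
      c * (ε * (1 + |w|)) ≤ ‖γ (ε * w) - γ 0 - ε * (Complex.I * deriv γ 0)‖ ∧
      c * (ε * (1 + |w|)) ≤ ‖γ (ε * w) - γ 0 - ε * (-Complex.I * deriv γ 0)‖ ∧
      ‖deriv γ (ε * w)‖ ≤ M := by
  obtain ⟨c, hc, ε₀, hε₀, H⟩ := h.exists_lower_bound
  obtain ⟨M, hM⟩ := (isCompact_Icc (a := (-(1 / 2) : ℝ)) (b := 1 / 2)).exists_bound_of_continuousOn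
    (h.contDiff.continuous_deriv le_rfl).continuousOn
  refine ⟨c, hc, M, (norm_nonneg _).trans (hM 0 (by constructor <;> norm_num)), ?_⟩
  filter_upwards [Ioo_mem_nhdsGT hε₀] with ε hε
  refine ⟨hε.1, fun w hw => ⟨?_, ?_, hM _ (abs_le.1 hw)⟩⟩
  · have := H ε (by rw [abs_of_pos hε.1]; exact hε.2) (ε * w) hw
    rw [abs_mul, abs_of_pos hε.1] at this
    linarith
  · have := H (-ε) (by rw [abs_neg, abs_of_pos hε.1]; exact hε.2) (ε * w) hw
    rw [abs_neg, abs_mul, abs_of_pos hε.1] at this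
    push_cast at this
    rw [show (ε : ℂ) * (-Complex.I * deriv γ 0) = -ε * (Complex.I * deriv γ 0) by ring]
    linarith

theorem one_add_sq_le_sq_one_add_abs (w : ℝ) : 1 + w ^ 2 ≤ (1 + |w|) ^ 2 := by
  have := abs_nonneg w
  nlinarith [sq_abs w]

/-- The jump of the Cauchy integral of `1` across the contour. -/
theorem tendsto_jump_cauchyIntegral (h : IsSmoothClosedContour 1 γ) :
    Tendsto (fun ε : ℝ => ∫ u in (-(1 / 2) : ℝ)..1 / 2,
      (deriv γ u / (γ u - γ 0 - ε * (Complex.I * deriv γ 0)) -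
        deriv γ u / (γ u - γ 0 - ε * (-Complex.I * deriv γ 0)))) (𝓝[>] 0)
      (𝓝 (2 * Real.pi * Complex.I)) := by
  have hc : Continuous γ := h.contDiff.continuous
  have hg : Continuous (deriv γ) := h.contDiff.continuous_deriv le_rfl
  obtain ⟨c, hc0, M, hM, hbd⟩ := h.exists_rescaled_bound
  set T := deriv γ 0 with hT
  -- The limiting kernel is `2i / (1 + w²)`.
  have hint : ∫ w : ℝ, (1 / ((w : ℂ) - Complex.I) - 1 / ((w : ℂ) - -Complex.I)) =
      2 * Real.pi * Complex.I := by
    have : ∀ w : ℝ, 1 / ((w : ℂ) - Complex.I) - 1 / ((w : ℂ) - -Complex.I) =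
        (2 * Complex.I) * (((1 + w ^ 2)⁻¹ : ℝ) : ℂ) := by
      intro w
      have h1 := ofReal_sub_I_ne_zero w
      have h2 := ofReal_add_I_ne_zero w
      have h3 : ((w : ℂ) - Complex.I) * (w - -Complex.I) = 1 + (w : ℂ) ^ 2 := by
        linear_combination -Complex.I_sq
      rw [div_sub_div _ _ h1 h2, h3]
      push_cast
      rw [div_eq_mul_inv]
      ring
    simp only [this]
    rw [MeasureTheory.integral_const_mul, integral_complex_ofReal, integral_univ_inv_one_add_sq]
    ring
  rw [← hint]
  refine tendsto_integral_of_rescaled (K := 2 * M * ‖T‖ / c ^ 2)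
    (k := fun ε u => deriv γ u / (γ u - γ 0 - ε * (Complex.I * T)) -
        deriv γ u / (γ u - γ 0 - ε * (-Complex.I * T))) (by positivity) ?_ ?_ ?_
  · intro ε
    have h1 := hg.measurable
    have h2 := hc.measurable
    fun_prop
  · filter_upwards [hbd] with ε ⟨hε, hε'⟩ w hw
    obtain ⟨h1, h2, h3⟩ := hε' w hw
    set A := γ (ε * w) - γ 0 - ε * (Complex.I * T)
    set B := γ (ε * w) - γ 0 - ε * (-Complex.I * T) with hB
    have hpos : 0 < c * (ε * (1 + |w|)) := by positivity
    have hA0 : A ≠ 0 := norm_pos_iff.1 (hpos.trans_le h1)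
    have hB0 : B ≠ 0 := norm_pos_iff.1 (hpos.trans_le h2)
    have hBA : B - A = 2 * ε * Complex.I * T := by simp only [A, B]; ring
    -- Subtracting the two fractions leaves `B - A = O(ε)` in the numerator, which gives the decay
    -- `1 / w²` needed for domination.
    have heq : (ε : ℂ) * (deriv γ (ε * w) / A - deriv γ (ε * w) / B) =
        ε * (deriv γ (ε * w) * (2 * ε * Complex.I * T)) / (A * B) := by
      rw [← hBA]; field_simp
    rw [heq, norm_div, norm_mul, norm_mul, norm_mul, norm_mul, norm_mul, norm_mul]
    simp only [Complex.norm_real, Complex.norm_ofNat, Complex.norm_I, Real.norm_eq_abs,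
      abs_of_pos hε]
    calc _ ≤ ε * (M * (2 * ε * 1 * ‖T‖)) / (c * (ε * (1 + |w|)) * (c * (ε * (1 + |w|)))) := by
          gcongr
      _ = 2 * M * ‖T‖ / c ^ 2 * ((1 + |w|) ^ 2)⁻¹ := by
          field_simp
      _ ≤ _ := by gcongr; exact one_add_sq_le_sq_one_add_abs w
  · refine Eventually.of_forall fun w => ?_
    simp only [mul_sub]
    exact (rescaled_tendsto_cauchyKernel h w (ofReal_sub_I_ne_zero w)).sub
      (rescaled_tendsto_cauchyKernel h w (ofReal_add_I_ne_zero w))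

/-- The mean of the limits of the Cauchy integral of `1` from both sides of the contour is the
principal value. -/
theorem tendsto_mean_cauchyIntegral (h : IsSmoothClosedContour 1 γ) :
    Tendsto (fun ε : ℝ => ∫ u in (-(1 / 2) : ℝ)..1 / 2,
      (deriv γ u / (γ u - γ 0 - ε * (Complex.I * deriv γ 0)) +
        deriv γ u / (γ u - γ 0 - ε * (-Complex.I * deriv γ 0)) -
        2 * {u | ε * ‖deriv γ 0‖ < ‖γ u - γ 0‖}.indicator (fun u => deriv γ u / (γ u - γ 0)) u))
      (𝓝[>] 0) (𝓝 0) := by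
  have hc : Continuous γ := h.contDiff.continuous
  have hg : Continuous (deriv γ) := h.contDiff.continuous_deriv le_rfl
  obtain ⟨c, hc0, M, hM, hbd⟩ := h.exists_rescaled_bound
  set T := deriv γ 0 with hT
  have hT0 : 0 < ‖T‖ := norm_pos_iff.2 (h.deriv_ne_zero 0)
  -- The limiting kernel is odd, so its integral vanishes. The cut-off radius `ε‖T‖` is chosen so
  -- that the cut-off becomes `|w| > 1`.
  let k₀ : ℝ → ℂ := fun w => 1 / ((w : ℂ) - Complex.I) + 1 / ((w : ℂ) - -Complex.I) -
    2 * {w : ℝ | 1 < |w|}.indicator (fun w : ℝ => 1 / (w : ℂ)) w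
  have hint : ∫ w, k₀ w = 0 := by
    have hodd : ∀ w, k₀ (-w) = -k₀ w := by
      intro w
      have h1 : ((-w : ℝ) : ℂ) - Complex.I = -((w : ℂ) - -Complex.I) := by push_cast; ring
      have h2 : ((-w : ℝ) : ℂ) - -Complex.I = -((w : ℂ) - Complex.I) := by push_cast; ring
      simp only [k₀, h1, h2, indicator, mem_ofPred_eq, abs_neg]
      split_ifs <;> (push_cast; simp only [div_neg]; ring)
    have h1 := MeasureTheory.integral_neg_eq_self k₀ MeasureTheory.volume
    simp only [hodd, MeasureTheory.integral_neg] at h1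
    exact self_eq_neg.1 h1.symm
  rw [← hint]
  refine tendsto_integral_of_rescaled (K := 2 * M * ‖T‖ / c ^ 2)
    (k := fun ε u => deriv γ u / (γ u - γ 0 - ε * (Complex.I * T)) +
        deriv γ u / (γ u - γ 0 - ε * (-Complex.I * T)) -
        2 * {u | ε * ‖T‖ < ‖γ u - γ 0‖}.indicator (fun u => deriv γ u / (γ u - γ 0)) u)
    (by positivity) ?_ ?_ ?_
  · intro ε
    have h1 := hg.measurable
    have h2 := hc.measurable
    have hm : MeasurableSet {u | ε * ‖T‖ < ‖γ u - γ 0‖} :=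
      (isOpen_lt continuous_const (by fun_prop)).measurableSet
    have h3 : Measurable ({u | ε * ‖T‖ < ‖γ u - γ 0‖}.indicator
      (fun u => deriv γ u / (γ u - γ 0))) := Measurable.indicator (by fun_prop) hm
    fun_prop
  · filter_upwards [hbd] with ε ⟨hε, hε'⟩ w hw
    obtain ⟨h1, h2, h3⟩ := hε' w hw
    set A := γ (ε * w) - γ 0 - ε * (Complex.I * T) with hA
    set B := γ (ε * w) - γ 0 - ε * (-Complex.I * T) with hB
    set a := γ (ε * w) - γ 0 with ha
    have hpos : 0 < c * (ε * (1 + |w|)) := by positivity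
    have hA0 : A ≠ 0 := norm_pos_iff.1 (hpos.trans_le h1)
    have hB0 : B ≠ 0 := norm_pos_iff.1 (hpos.trans_le h2)
    have hAB : A + B = 2 * a := by simp only [A, B]; ring
    have hfin : ε * (M * (2 * (ε * ‖T‖))) / (c * (ε * (1 + |w|)) * (c * (ε * (1 + |w|)))) ≤
        2 * M * ‖T‖ / c ^ 2 * (1 + w ^ 2)⁻¹ := by
      calc _ = 2 * M * ‖T‖ / c ^ 2 * ((1 + |w|) ^ 2)⁻¹ := by field_simp
        _ ≤ _ := by gcongr; exact one_add_sq_le_sq_one_add_abs w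
    refine le_trans ?_ hfin
    -- Outside the cut-off, `1/A + 1/B - 2/a = -2(εT)² / (aAB)` with `‖εT / a‖ ≤ 1`. Inside, the sum
    -- is `2a / (AB)` with `‖a‖ ≤ ε‖T‖`. Both cases give the same bound.
    by_cases hin : ε * ‖T‖ < ‖a‖
    · rw [indicator_of_mem (by exact hin)]
      have ha0 : a ≠ 0 := norm_pos_iff.1 (lt_trans (by positivity) hin)
      have hABm : A * B = a ^ 2 + (ε * T) ^ 2 := by
        simp only [A, B]
        linear_combination -(ε * T) ^ 2 * Complex.I_sq
      have heq : (ε : ℂ) * (deriv γ (ε * w) / A + deriv γ (ε * w) / B - 2 * (deriv γ (ε * w) / a)) =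
          -(ε * (deriv γ (ε * w) * (2 * ((ε * T) * ((ε * T) / a)))) / (A * B)) := by
        have : deriv γ (ε * w) / A + deriv γ (ε * w) / B = deriv γ (ε * w) * (2 * a) / (A * B) := by
          rw [← hAB]; field_simp
          ring
        rw [this]
        field_simp
        rw [hABm]
        ring
      rw [heq, norm_neg, norm_div, norm_mul, norm_mul, norm_mul, norm_mul, norm_mul, norm_div,
        norm_mul, norm_mul]
      simp only [Complex.norm_real, Complex.norm_ofNat, Real.norm_eq_abs, abs_of_pos hε]
      have h4 : ε * ‖T‖ / ‖a‖ ≤ 1 := (div_le_one (norm_pos_iff.2 ha0)).2 hin.le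
      have h5 : ε * ‖T‖ * (ε * ‖T‖ / ‖a‖) ≤ ε * ‖T‖ := mul_le_of_le_one_right (by positivity) h4
      have h6 : 0 ≤ ε * ‖T‖ * (ε * ‖T‖ / ‖a‖) := by positivity
      generalize ε * ‖T‖ * (ε * ‖T‖ / ‖a‖) = y at h5 h6 ⊢
      gcongr
    · rw [indicator_of_notMem (by exact hin), mul_zero, sub_zero]
      have heq : (ε : ℂ) * (deriv γ (ε * w) / A + deriv γ (ε * w) / B) =
          ε * (deriv γ (ε * w) * (2 * a)) / (A * B) := by
        rw [← hAB]; field_simp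
        ring
      rw [heq, norm_div, norm_mul, norm_mul, norm_mul, norm_mul]
      simp only [Complex.norm_real, Complex.norm_ofNat, Real.norm_eq_abs, abs_of_pos hε]
      rw [not_lt] at hin
      gcongr
  -- At `w = ±1` the indicator need not converge, but two points are negligible.
  · have hae : ∀ᵐ w : ℝ, w ∉ ({1, -1} : Set ℝ) :=
      MeasureTheory.measure_eq_zero_iff_ae_notMem.1
        ((Set.toFinite ({1, -1} : Set ℝ)).measure_zero _)
    filter_upwards [hae] with w hw
    simp only [mul_sub, mul_add]
    refine ((rescaled_tendsto_cauchyKernel h w (ofReal_sub_I_ne_zero w)).add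
      (rescaled_tendsto_cauchyKernel h w (ofReal_add_I_ne_zero w))).sub ?_
    have hd : HasDerivAt γ T 0 := (h.contDiff.differentiable one_ne_zero 0).hasDerivAt
    have hlim : Tendsto (fun ε : ℝ => ‖γ (ε * w) - γ 0‖ / ε) (𝓝[>] 0) (𝓝 (|w| * ‖T‖)) := by
      have := (tendsto_rescaled_contour hd w).norm
      rw [norm_mul, Complex.norm_real, Real.norm_eq_abs] at this
      refine this.congr' ?_
      filter_upwards [self_mem_nhdsWithin] with ε (hε : 0 < ε)
      rw [norm_div, Complex.norm_real, Real.norm_eq_abs, abs_of_pos hε]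
    rcases lt_or_gt_of_ne (show |w| ≠ 1 from fun h => hw ((abs_eq zero_le_one).1 h)) with h1 | h1
    · rw [indicator_of_notMem (by simpa using h1.le), mul_zero]
      refine tendsto_const_nhds.congr' ?_
      filter_upwards [self_mem_nhdsWithin, hlim.eventually_lt_const
        (mul_lt_of_lt_one_left hT0 h1)] with ε (hε : 0 < ε) hε'
      rw [div_lt_iff₀ hε] at hε'
      rw [indicator_of_notMem, mul_zero, mul_zero]
      rw [mem_ofPred_eq, not_lt]
      linarith
    · rw [indicator_of_mem (by simpa using h1)]
      have hw0 : (w : ℂ) - 0 ≠ 0 := by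
        rw [sub_zero]
        have : w ≠ 0 := by rintro rfl; simp at h1; linarith
        exact_mod_cast this
      have h2 := (rescaled_tendsto_cauchyKernel h w hw0).const_mul 2
      simp only [zero_mul, mul_zero, sub_zero] at h2
      refine h2.congr' ?_
      filter_upwards [self_mem_nhdsWithin, hlim.eventually_const_lt
        (lt_mul_of_one_lt_left hT0 h1)] with ε (hε : 0 < ε) hε'
      rw [lt_div_iff₀ hε] at hε'
      rw [indicator_of_mem]
      · ring
      · rw [mem_ofPred_eq]
        linarith

end Contour

/-! ### The principal value of the Cauchy kernel -/

section Contour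

variable {γ : ℝ → ℂ}

theorem windingIntegral_eq_zero_or (h : IsSmoothClosedContour 1 γ) (hor : IsPositivelyOriented γ)
    {z : ℂ} (hz : z ∉ range γ) :
    ∫ u in (0 : ℝ)..1, deriv γ u / (γ u - z) = 0 ∨
      ∫ u in (0 : ℝ)..1, deriv γ u / (γ u - z) = 2 * Real.pi * Complex.I := by
  by_cases hi : z ∈ innerDomain γ
  · exact Or.inr (hor z hi)
  · exact Or.inl (windingIntegral_eq_zero h.periodic h.contDiff
      (by rw [mem_union, not_or]; exact ⟨hz, hi⟩))

theorem range_eq_image_symm_interval (hper : Function.Periodic γ 1) :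
    γ '' Icc (-(1 / 2)) (1 / 2) = range γ := by
  have := hper.image_Icc one_pos (-(1 / 2))
  norm_num at this ⊢
  exact this

/-- The principal value of the Cauchy integral of `1` at a point of the contour. -/
theorem tendsto_truncatedIntegral_one_one (h : IsSmoothClosedContour 1 γ)
    (hor : IsPositivelyOriented γ) :
    Tendsto (truncatedIntegral γ 1 (fun _ => 1) (γ 0)) (𝓝[>] 0) (𝓝 (Real.pi * Complex.I)) := by
  have hc : Continuous γ := h.contDiff.continuous
  have hg : Continuous (deriv γ) := h.contDiff.continuous_deriv le_rfl
  set T := deriv γ 0 with hT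
  have hT0 : 0 < ‖T‖ := norm_pos_iff.2 (h.deriv_ne_zero 0)
  obtain ⟨c, hc0, ε₀, hε₀, H⟩ := h.exists_lower_bound
  let W : ℂ → ℂ := fun z => ∫ u in (0 : ℝ)..1, deriv γ u / (γ u - z)
  have hW : ∀ z, W z = ∫ u in (-(1 / 2) : ℝ)..1 / 2, deriv γ u / (γ u - z) := by
    intro z
    have hp : Function.Periodic (fun u => deriv γ u / (γ u - z)) 1 := fun u => by
      simp only [h.periodic u, h.periodic.deriv_of_periodic u]
    have := hp.intervalIntegral_add_eq 0 (-(1 / 2))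
    norm_num at this ⊢
    exact this
  have hoff : ∀ b : ℝ, b ≠ 0 → |b| < ε₀ → γ 0 + b * (Complex.I * T) ∉ range γ := by
    intro b hb0 hb
    rw [← range_eq_image_symm_interval h.periodic]
    rintro ⟨u, hu, hu'⟩
    have h1 := H b hb u (abs_le.2 hu)
    rw [hu', add_sub_cancel_left, sub_self, norm_zero] at h1
    have : 0 < |b| := abs_pos.2 hb0
    have h2 : 0 < c * (|u| + |b|) := by positivity
    linarith
  have hint : ∀ b : ℝ, b ≠ 0 → |b| < ε₀ → IntervalIntegrable
      (fun u => deriv γ u / (γ u - (γ 0 + b * (Complex.I * T)))) MeasureTheory.volume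
      (-(1 / 2)) (1 / 2) := by
    intro b hb0 hb
    refine Continuous.intervalIntegrable (hg.div (by fun_prop) fun u hu => ?_) _ _
    exact hoff b hb0 hb ⟨u, sub_eq_zero.1 hu⟩
  have hjump : Tendsto (fun ε : ℝ => W (γ 0 + ε * (Complex.I * T)) -
      W (γ 0 + (-ε : ℝ) * (Complex.I * T))) (𝓝[>] 0) (𝓝 (2 * Real.pi * Complex.I)) := by
    refine (tendsto_jump_cauchyIntegral h).congr' ?_
    filter_upwards [Ioo_mem_nhdsGT hε₀] with ε hε
    have hε1 : |ε| < ε₀ := by rw [abs_of_pos hε.1]; exact hε.2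
    rw [hW, hW, ← intervalIntegral.integral_sub (hint ε hε.1.ne' hε1)
      (hint (-ε) (neg_ne_zero.2 hε.1.ne') (by rwa [abs_neg]))]
    refine intervalIntegral.integral_congr fun u _ => ?_
    simp only [sub_add_eq_sub_sub]
    push_cast
    simp only [neg_mul, mul_neg, hT]
  have hsum : Tendsto (fun ε : ℝ => W (γ 0 + ε * (Complex.I * T)) +
      W (γ 0 + (-ε : ℝ) * (Complex.I * T)) -
        2 * truncatedIntegral γ 1 (fun _ => 1) (γ 0) (ε * ‖T‖)) (𝓝[>] 0) (𝓝 0) := by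
    refine (tendsto_mean_cauchyIntegral h).congr' ?_
    filter_upwards [Ioo_mem_nhdsGT hε₀] with ε hε
    have hε1 : |ε| < ε₀ := by rw [abs_of_pos hε.1]; exact hε.2
    have hi1 := hint ε hε.1.ne' hε1
    have hi2 := hint (-ε) (neg_ne_zero.2 hε.1.ne') (by rwa [abs_neg])
    have hi3 : IntervalIntegrable ({u | ε * ‖T‖ < ‖γ u - γ 0‖}.indicator
        (fun u => deriv γ u / (γ u - γ 0))) MeasureTheory.volume (-(1 / 2)) (1 / 2) :=
      intervalIntegrable_truncated hc (hg.continuousOn.div (by fun_prop)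
        fun u hu => sub_ne_zero.2 hu) (mul_pos hε.1 hT0) _ _
    rw [hW, hW, truncatedIntegral_eq_symm_interval h.periodic hc,
      ← intervalIntegral.integral_add hi1 hi2, ← intervalIntegral.integral_const_mul,
      ← intervalIntegral.integral_sub]
    · refine intervalIntegral.integral_congr fun u _ => ?_
      simp only [sub_add_eq_sub_sub, indicator, pow_one, one_div_mul_eq_div]
      push_cast
      simp only [neg_mul, mul_neg]
      rfl
    · exact hi1.add hi2
    · refine IntervalIntegrable.const_mul ?_ 2
      simp only [pow_one, one_div_mul_eq_div]
      exact hi3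
  -- Both values belong to `{0, 2πi}` and their difference tends to `2πi`. For small `ε` they are
  -- therefore distinct, and their sum is exactly `2πi`.
  have hval : ∀ᶠ ε : ℝ in 𝓝[>] 0, W (γ 0 + ε * (Complex.I * T)) +
      W (γ 0 + (-ε : ℝ) * (Complex.I * T)) = 2 * Real.pi * Complex.I := by
    have hpi : (2 * Real.pi * Complex.I : ℂ) ≠ 0 := Complex.two_pi_I_ne_zero
    have hpi' : -(2 * Real.pi * Complex.I : ℂ) ≠ 2 * Real.pi * Complex.I := fun h =>
      hpi (self_eq_neg.1 h.symm)
    filter_upwards [Ioo_mem_nhdsGT hε₀, hjump.eventually_ne hpi,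
      hjump.eventually_ne hpi'.symm] with ε hε h1 h2
    have hε1 : |ε| < ε₀ := by rw [abs_of_pos hε.1]; exact hε.2
    rcases windingIntegral_eq_zero_or h hor (hoff ε hε.1.ne' hε1) with h3 | h3 <;>
      rcases windingIntegral_eq_zero_or h hor
        (hoff (-ε) (neg_ne_zero.2 hε.1.ne') (by rwa [abs_neg])) with h4 | h4 <;>
      simp only [W, h3, h4] at h1 h2 ⊢ <;> simp at h1 h2 ⊢
  have hpv : Tendsto (fun ε : ℝ => truncatedIntegral γ 1 (fun _ => 1) (γ 0) (ε * ‖T‖)) (𝓝[>] 0)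
      (𝓝 (Real.pi * Complex.I)) := by
    have h1 := (hsum.const_sub (2 * Real.pi * Complex.I)).div_const 2
    have h2 : (2 * Real.pi * Complex.I - 0 : ℂ) / 2 = Real.pi * Complex.I := by ring
    rw [h2] at h1
    refine h1.congr' ?_
    filter_upwards [hval] with ε hε
    rw [hε]; ring
  -- The limit was taken along cut-off radii `ε‖T‖`; this returns to the radius `v`.
  have hscale : Tendsto (fun v : ℝ => v / ‖T‖) (𝓝[>] 0) (𝓝[>] 0) := by
    rw [tendsto_nhdsWithin_iff]
    constructor
    · have : Tendsto (fun v : ℝ => v / ‖T‖) (𝓝 0) (𝓝 (0 / ‖T‖)) :=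
        (continuous_id.div_const _).tendsto 0
      rw [zero_div] at this
      exact this.mono_left nhdsWithin_le_nhds
    · filter_upwards [self_mem_nhdsWithin] with v (hv : 0 < v) using div_pos hv hT0
  refine (hpv.comp hscale).congr fun v => ?_
  simp only [Function.comp_apply, div_mul_cancel₀ _ hT0.ne']

end Contour

/-! ### Finite parts of higher negative powers -/

theorem hasDerivAt_integral_pow_smul_comp_mul {f : ℝ → ℂ} (hf : ContDiff ℝ 1 f) (j : ℕ) (u : ℝ) :
    HasDerivAt (fun u => ∫ s in (0 : ℝ)..1, s ^ j • f (s * u))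
      (∫ s in (0 : ℝ)..1, s ^ (j + 1) • deriv f (s * u)) u := by
  have hc := hf.continuous
  have hd : Continuous (deriv f) := hf.continuous_deriv le_rfl
  have hK : IsCompact (uIcc (0 : ℝ) 1 ×ˢ Metric.closedBall u 1) :=
    isCompact_uIcc.prod (isCompact_closedBall u 1)
  obtain ⟨C, hC⟩ := hK.exists_bound_of_continuousOn
    (f := fun q : ℝ × ℝ => q.1 ^ (j + 1) • deriv f (q.1 * q.2)) (by fun_prop)
  refine (intervalIntegral.hasDerivAt_integral_of_dominated_loc_of_deriv_le
    (F := fun u s => s ^ j • f (s * u)) (F' := fun u s => s ^ (j + 1) • deriv f (s * u))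
    (bound := fun _ => C)
    (Metric.ball_mem_nhds u one_pos) (Eventually.of_forall fun v => ?_) ?_ ?_ ?_ ?_ ?_).2
  · exact (show Continuous fun s => s ^ j • f (s * v) by fun_prop).aestronglyMeasurable
  · exact (show Continuous fun s => s ^ j • f (s * u) by fun_prop).intervalIntegrable _ _
  · exact (show Continuous fun s => s ^ (j + 1) • deriv f (s * u) by fun_prop).aestronglyMeasurable
  · refine Eventually.of_forall fun s hs v hv => ?_
    exact hC (s, v) ⟨uIoc_subset_uIcc hs, Metric.ball_subset_closedBall hv⟩
  · simp
  · refine Eventually.of_forall fun s _ v _ => ?_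
    have h1 : HasDerivAt (fun v => s * v) s v := by
      simpa using (hasDerivAt_id v).const_mul s
    have h2 := ((hf.differentiable one_ne_zero (s * v)).hasDerivAt.scomp v h1).const_smul (s ^ j)
    rw [smul_smul, ← pow_succ] at h2
    exact h2

/-- Each differentiation replaces `f` by `deriv f` and `j` by `j + 1`, so the induction needs all
weights `s ^ j`. The case `j = 0`, applied to a derivative, gives the Hadamard quotient. -/
theorem contDiff_integral_pow_smul_comp_mul {n : ℕ} {f : ℝ → ℂ} (hf : ContDiff ℝ n f) (j : ℕ) :
    ContDiff ℝ n (fun u => ∫ s in (0 : ℝ)..1, s ^ j • f (s * u)) := by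
  induction n generalizing f j with
  | zero =>
    have hc := hf.continuous
    exact contDiff_zero.2 (intervalIntegral.continuous_parametric_intervalIntegral_of_continuous'
      (by fun_prop) 0 1)
  | succ n ih =>
    have h1 : ContDiff ℝ 1 f := hf.of_le (by exact_mod_cast Nat.le_add_left 1 n)
    push_cast at hf ⊢
    rw [contDiff_succ_iff_deriv] at hf ⊢
    refine ⟨fun u => (hasDerivAt_integral_pow_smul_comp_mul h1 j u).differentiableAt, by simp, ?_⟩
    have : deriv (fun u => ∫ s in (0 : ℝ)..1, s ^ j • f (s * u)) =
        fun u => ∫ s in (0 : ℝ)..1, s ^ (j + 1) • deriv f (s * u) :=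
      funext fun u => (hasDerivAt_integral_pow_smul_comp_mul h1 j u).deriv
    rw [this]
    exact ih hf.2.2 (j + 1)

/-- **Hadamard's lemma** on the line. -/
theorem ContDiff.exists_eq_mul {n : ℕ} {f : ℝ → ℂ} (hf : ContDiff ℝ (n + 1 : ℕ) f) :
    ∃ g : ℝ → ℂ, ContDiff ℝ n g ∧ g 0 = deriv f 0 ∧ ∀ u, f u - f 0 = u * g u := by
  have h1 : ContDiff ℝ 1 f := hf.of_le (by exact_mod_cast Nat.le_add_left 1 n)
  have hd : Continuous (deriv f) := h1.continuous_deriv le_rfl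
  push_cast at hf
  have h2 := contDiff_integral_pow_smul_comp_mul (contDiff_succ_iff_deriv.1 hf).2.2 0
  refine ⟨_, h2, by simp, fun u => ?_⟩
  have h3 : ∀ s ∈ uIcc (0 : ℝ) 1, HasDerivAt (fun s => f (s * u)) (u * deriv f (s * u)) s := by
    intro s _
    have h4 : HasDerivAt (fun s => s * u) u s := by simpa using (hasDerivAt_id s).mul_const u
    rw [← Complex.real_smul]
    exact (h1.differentiable one_ne_zero (s * u)).hasDerivAt.scomp s h4
  have h5 := intervalIntegral.integral_eq_sub_of_hasDerivAt h3
    ((show Continuous fun s : ℝ => (u : ℂ) * deriv f (s * u) by fun_prop).intervalIntegrable _ _)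
  rw [intervalIntegral.integral_const_mul] at h5
  simpa using h5.symm

/-- Taylor's formula of order `M` with Peano remainder: after division by `(±v) ^ M` the remainder
tends to zero, the terms of order `M` cancel between `v` and `-v`, and only negative powers remain.
-/
theorem exists_tendsto_of_contDiffAt {M : ℕ} {q : ℝ → ℂ} (hq : ContDiffAt ℝ M q 0) :
    ∃ d : ℕ → ℂ, Tendsto (fun v : ℝ => (q v / (v : ℂ) ^ M - q (-v) / ((-v : ℝ) : ℂ) ^ M) +
      ∑ k ∈ Finset.Icc 1 M, d k / (v : ℂ) ^ k) (𝓝[>] 0) (𝓝 0) := by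
  obtain ⟨U, hU, hqU⟩ := hq.contDiffOn le_rfl (by simp)
  obtain ⟨r, hr, hrU⟩ := Metric.mem_nhds_iff.1 hU
  have hT := taylor_isLittleO (convex_ball (0 : ℝ) r) (Metric.mem_ball_self hr) (hqU.mono hrU)
  rw [nhdsWithin_eq_nhds.2 (Metric.ball_mem_nhds 0 hr)] at hT
  simp only [taylor_within_apply, sub_zero] at hT
  set c : ℕ → ℂ := fun k =>
    (((Nat.factorial k : ℝ)⁻¹ : ℝ) : ℂ) * iteratedDerivWithin k q (Metric.ball 0 r) 0 with hc
  have hterm : ∀ (v : ℝ) (k : ℕ), ((Nat.factorial k : ℝ)⁻¹ * v ^ k) •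
      iteratedDerivWithin k q (Metric.ball 0 r) 0 = c k * (v : ℂ) ^ k := by
    intro v k
    rw [Complex.real_smul, hc]; push_cast; ring
  simp only [hterm] at hT
  set P : ℝ → ℂ := fun v => ∑ k ∈ Finset.range (M + 1), c k * (v : ℂ) ^ k with hP
  have h1 : Tendsto (fun v : ℝ => (q v - P v) / (v : ℂ) ^ M) (𝓝 0) (𝓝 0) := by
    rw [tendsto_zero_iff_norm_tendsto_zero]
    have := hT.norm_norm.tendsto_div_nhds_zero
    simpa using this
  have h2 : Tendsto (fun v : ℝ => -v) (𝓝 0) (𝓝 0) := by simpa using (continuous_neg (G := ℝ)).tendsto 0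
  have h3 := (h1.sub (h1.comp h2)).mono_left (nhdsWithin_le_nhds (s := Ioi 0))
  -- The coefficient of `v ^ (-k)` comes from the Taylor term of order `M - k`; the factor is `1 -
  -- (-1) ^ k` since `(-v) ^ (-k) = (-1) ^ k v ^ (-k)`.
  refine ⟨fun k => -(c (M - k) * (1 - (-1) ^ k)), ?_⟩
  rw [sub_zero] at h3
  refine h3.congr' ?_
  filter_upwards [self_mem_nhdsWithin] with v (hv : 0 < v)
  have hv0 : (v : ℂ) ≠ 0 := by exact_mod_cast hv.ne'
  have hPv : P v / (v : ℂ) ^ M - P (-v) / ((-v : ℝ) : ℂ) ^ M =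
      ∑ k ∈ Finset.Icc 1 M, c (M - k) * (1 - (-1) ^ k) / (v : ℂ) ^ k := by
    rw [hP]
    simp only
    rw [Finset.sum_div, Finset.sum_div, ← Finset.sum_sub_distrib, Finset.sum_range_succ]
    have hnv : ((-v : ℝ) : ℂ) ≠ 0 := by push_cast; exact neg_ne_zero.2 hv0
    rw [mul_div_cancel_right₀ _ (pow_ne_zero _ hv0), mul_div_cancel_right₀ _ (pow_ne_zero _ hnv),
      sub_self, add_zero]
    refine Finset.sum_bij' (fun j _ => M - j) (fun k _ => M - k) ?_ ?_ ?_ ?_ ?_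
    · intro j hj; simp at hj ⊢; omega
    · intro j hj; simp at hj ⊢; omega
    · intro j hj; simp at hj; omega
    · intro j hj; simp at hj; omega
    · intro j hj
      rw [Finset.mem_range] at hj
      obtain ⟨k, rfl⟩ := Nat.exists_eq_add_of_lt hj
      have e1 : j + k + 1 - j = k + 1 := by omega
      have e2 : ∀ x : ℂ, x ≠ 0 → c j * x ^ j / x ^ (j + (k + 1)) = c j / x ^ (k + 1) := by
        intro x hx
        rw [pow_add]
        field_simp
      rw [e1, show j + k + 1 - (k + 1) = j by omega, add_assoc, e2 _ hv0, e2 _ hnv]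
      push_cast
      rw [neg_pow (v : ℂ) (k + 1)]
      rcases neg_one_pow_eq_or ℂ (k + 1) with h | h <;> rw [h] <;> ring
  simp only [Function.comp_apply, neg_div, Finset.sum_neg_distrib, ← hPv]
  ring

/-- A local inverse of a smooth function on the line with positive derivative. -/
theorem exists_local_inverse_of_deriv_pos {M : ℕ} (hM : M ≠ 0) {s : ℝ → ℝ}
    (hs : ContDiffAt ℝ M s 0) (h0 : s 0 = 0) {d : ℝ} (hd : HasDerivAt s d 0) (hd0 : 0 < d) :
    ∃ ρ : ℝ → ℝ, ContDiffAt ℝ M ρ 0 ∧ ρ 0 = 0 ∧ (∀ᶠ v in 𝓝 0, s (ρ v) = v) ∧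
      ∃ δ > 0, StrictMonoOn s (Ioo (-δ) δ) := by
  have hM' : (M : WithTop ℕ∞) ≠ 0 := by exact_mod_cast hM
  let e : ℝ ≃L[ℝ] ℝ := ContinuousLinearEquiv.unitsEquivAut ℝ (Units.mk0 d hd0.ne')
  have hf : HasFDerivAt s (e : ℝ →L[ℝ] ℝ) 0 := by
    have he : (e : ℝ →L[ℝ] ℝ) = ContinuousLinearMap.toSpanSingleton ℝ d := by
      ext
      simp [e]
    rw [he]
    exact hd.hasFDerivAt
  refine ⟨hs.localInverse hf hM', ?_, ?_, ?_, ?_⟩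
  · have := hs.to_localInverse hf hM'
    rwa [h0] at this
  · have := hs.localInverse_apply_image hf hM'
    rwa [h0] at this
  · have := (hs.hasStrictFDerivAt' hf hM').eventually_right_inverse
    rwa [h0] at this
  · have h1 := (hs.hasStrictFDerivAt' hf hM').isLittleO.bound (half_pos hd0)
    obtain ⟨δ, hδ, h2⟩ := Metric.eventually_nhds_iff_ball.1 h1
    refine ⟨δ, hδ, fun x hx y hy hxy => ?_⟩
    have h3 := h2 (y, x) (by
      rw [← ball_prod_same]
      exact ⟨by simpa [abs_lt] using hy, by simpa [abs_lt] using hx⟩)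
    simp [e] at h3
    rw [abs_of_pos (sub_pos.2 hxy)] at h3
    have h4 := (abs_le.1 h3).1
    nlinarith

section Contour

variable {γ : ℝ → ℂ}

theorem hasDerivAt_inv_pow_contour {M : ℕ} (hM : M ≠ 0) {t : ℂ} {u : ℝ}
    (hd : DifferentiableAt ℝ γ u) (hne : γ u ≠ t) :
    HasDerivAt (fun u => -(1 / (M : ℂ)) * ((γ u - t) ^ M)⁻¹)
      (1 / (γ u - t) ^ (M + 1) * deriv γ u) u := by
  have h0 : γ u - t ≠ 0 := sub_ne_zero.2 hne
  have hM0 : (M : ℂ) ≠ 0 := by exact_mod_cast hM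
  refine ((((hd.hasDerivAt.sub_const t).fun_pow M).fun_inv (pow_ne_zero M h0)).const_mul
    (-(1 / (M : ℂ)))).congr_deriv ?_
  obtain ⟨k, rfl⟩ := Nat.exists_eq_succ_of_ne_zero hM
  simp only [Nat.succ_eq_add_one, Nat.add_sub_cancel] at *
  field_simp
  ring

theorem IsSmoothClosedContour.exists_norm_sub_lower_bound (h : IsSmoothClosedContour 1 γ) {δ : ℝ} (hδ : 0 < δ) :
    ∃ d > 0, ∀ u ∈ Icc (-(1 / 2) : ℝ) (1 / 2), δ ≤ |u| → d ≤ ‖γ u - γ 0‖ := by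
  obtain ⟨c, hc, ε₀, hε₀, H⟩ := h.exists_lower_bound
  refine ⟨c * δ, by positivity, fun u hu hu' => ?_⟩
  have := H 0 (by simpa using hε₀) u (abs_le.2 hu)
  simp at this
  exact le_trans (by gcongr) this

/-- The truncated integral of a negative power in terms of the two end points of the arc cut off,
provided that the part of the contour cut off is an arc. -/
theorem truncatedIntegral_one_eq_of_arc {M : ℕ} (hM : M ≠ 0) (h : IsSmoothClosedContour 1 γ)
    {v ρ₁ ρ₂ : ℝ} (hv : 0 < v) (h1 : ρ₁ ∈ Ioo (-(1 / 2) : ℝ) 0) (h2 : ρ₂ ∈ Ioo (0 : ℝ) (1 / 2))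
    (hset : ∀ u ∈ Icc (-(1 / 2) : ℝ) (1 / 2), v < ‖γ u - γ 0‖ ↔ u < ρ₁ ∨ ρ₂ < u) :
    truncatedIntegral γ (M + 1) (fun _ => 1) (γ 0) v =
      1 / (M : ℂ) * ((γ ρ₂ - γ 0) ^ M)⁻¹ - 1 / (M : ℂ) * ((γ ρ₁ - γ 0) ^ M)⁻¹ := by
  have hc : Continuous γ := h.contDiff.continuous
  have hg : Continuous (deriv γ) := h.contDiff.continuous_deriv le_rfl
  have hdiff := h.contDiff.differentiable one_ne_zero
  set F : ℝ → ℂ := {u | v < ‖γ u - γ 0‖}.indicator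
    (fun u => 1 / (γ u - γ 0) ^ (M + 1) * deriv γ u) with hF
  have hint : ∀ a b, IntervalIntegrable F MeasureTheory.volume a b := by
    intro a b
    refine intervalIntegrable_truncated hc (ContinuousOn.mul (ContinuousOn.div (by fun_prop)
      (by fun_prop) fun u hu => pow_ne_zero _ (sub_ne_zero.2 hu)) hg.continuousOn) hv a b
  -- A primitive off `u = 0`; its values at `±1/2` agree because the contour is closed.
  set Q : ℝ → ℂ := fun u => -(1 / (M : ℂ)) * ((γ u - γ 0) ^ M)⁻¹ with hQ
  have hQd : ∀ u ∈ Icc (-(1 / 2) : ℝ) (1 / 2), u ≠ 0 →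
      HasDerivAt Q (1 / (γ u - γ 0) ^ (M + 1) * deriv γ u) u := fun u hu hu0 =>
    hasDerivAt_inv_pow_contour hM (hdiff u) (h.ne_of_mem hu0 hu)
  have hQper : Q (1 / 2) = Q (-(1 / 2)) := by
    have : γ (1 / 2) = γ (-(1 / 2)) := by
      rw [← h.periodic (-(1 / 2))]; norm_num
    simp only [hQ, this]
  rw [truncatedIntegral_eq_symm_interval h.periodic hc,
    ← intervalIntegral.integral_add_adjacent_intervals (hint _ ρ₁) (hint _ _),
    ← intervalIntegral.integral_add_adjacent_intervals (hint ρ₁ ρ₂) (hint _ _)]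
  have e1 : ∫ u in (-(1 / 2) : ℝ)..ρ₁, F u = Q ρ₁ - Q (-(1 / 2)) := by
    refine intervalIntegral.integral_eq_sub_of_hasDerivAt_of_le h1.1.le ?_ ?_ (hint _ _)
    · intro u hu
      exact (hQd u ⟨hu.1, by linarith [hu.2, h1.2]⟩
        (by linarith [hu.2, h1.2] : u < 0).ne).continuousAt.continuousWithinAt
    · intro u hu
      have hu' : u ∈ Icc (-(1 / 2) : ℝ) (1 / 2) := ⟨hu.1.le, by linarith [hu.2, h1.2]⟩
      have : F u = 1 / (γ u - γ 0) ^ (M + 1) * deriv γ u :=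
        indicator_of_mem (show u ∈ {u | v < ‖γ u - γ 0‖} from (hset u hu').2 (Or.inl hu.2)) _
      rw [this]
      exact hQd u hu' (by linarith [hu.2, h1.2] : u < 0).ne
  have e2 : ∫ u in ρ₁..ρ₂, F u = 0 := by
    rw [intervalIntegral.integral_congr (g := fun _ => 0)]
    · simp
    · intro u hu
      rw [uIcc_of_le (h1.2.trans h2.1).le] at hu
      refine indicator_of_notMem (fun hu' => ?_) _
      rcases (hset u ⟨by linarith [hu.1, h1.1], by linarith [hu.2, h2.2]⟩).1 hu' with h3 | h3
      · exact absurd hu.1 (not_le.2 h3)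
      · exact absurd hu.2 (not_le.2 h3)
  have e3 : ∫ u in ρ₂..(1 / 2 : ℝ), F u = Q (1 / 2) - Q ρ₂ := by
    refine intervalIntegral.integral_eq_sub_of_hasDerivAt_of_le h2.2.le ?_ ?_ (hint _ _)
    · intro u hu
      exact (hQd u ⟨by linarith [hu.1, h2.1], hu.2⟩
        (by linarith [hu.1, h2.1] : 0 < u).ne').continuousAt.continuousWithinAt
    · intro u hu
      have hu' : u ∈ Icc (-(1 / 2) : ℝ) (1 / 2) := ⟨by linarith [hu.1, h2.1], hu.2.le⟩
      have : F u = 1 / (γ u - γ 0) ^ (M + 1) * deriv γ u :=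
        indicator_of_mem (show u ∈ {u | v < ‖γ u - γ 0‖} from (hset u hu').2 (Or.inr hu.1)) _
      rw [this]
      exact hQd u hu' (by linarith [hu.1, h2.1] : 0 < u).ne'
  rw [e1, e2, e3, hQper]
  simp only [hQ]
  ring

/-- The finite part of the integral of `(τ - t) ^ (-(M + 1))`, `M ≥ 1`, over a closed contour
vanishes. -/
theorem exists_tendsto_truncatedIntegral_one {M : ℕ} (hM : M ≠ 0)
    (h : IsSmoothClosedContour (M + 1) γ) :
    ∃ d : ℕ → ℂ, Tendsto (fun v : ℝ => truncatedIntegral γ (M + 1) (fun _ => 1) (γ 0) v +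
      ∑ k ∈ Finset.Icc 1 M, d k / (v : ℂ) ^ k) (𝓝[>] 0) (𝓝 0) := by
  have hh : IsSmoothClosedContour 1 γ :=
    ⟨h.periodic, h.contDiff.of_le (by exact_mod_cast Nat.le_add_left 1 M), h.deriv_ne_zero, h.injOn⟩
  -- With `γ u - γ 0 = u g(u)`, the function `u ‖g u‖` is a signed distance to `γ 0` of class `C^M`.
  -- It has a local inverse `ρ`, and the end points of the arc cut off at radius `v` have parameters
  -- `ρ (±v)`.
  obtain ⟨g, hg, hg0, hgu⟩ := h.contDiff.exists_eq_mul
  have hgne : g 0 ≠ 0 := hg0 ▸ h.deriv_ne_zero 0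
  have hM' : (M : WithTop ℕ∞) ≠ 0 := by exact_mod_cast hM
  have hnorm : ContDiffAt ℝ M (fun u => ‖g u‖) 0 := hg.contDiffAt.norm ℝ hgne
  have hs : ContDiffAt ℝ M (fun u => u * ‖g u‖) 0 := contDiffAt_id.mul hnorm
  have hsd : HasDerivAt (fun u => u * ‖g u‖) ‖g 0‖ 0 := by
    have := (hasDerivAt_id (0 : ℝ)).fun_mul (hnorm.differentiableAt hM').hasDerivAt
    simpa using this
  have habs : ∀ u, |u * ‖g u‖| = ‖γ u - γ 0‖ := by
    intro u
    rw [hgu, norm_mul, abs_mul, abs_norm, Complex.norm_real, Real.norm_eq_abs]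
  obtain ⟨ρ, hρ, hρ0, hsρ, δ, hδ, hmono⟩ :=
    exists_local_inverse_of_deriv_pos hM hs (by simp) hsd (norm_pos_iff.2 hgne)
  set η := min δ (1 / 2) with hη
  have hη0 : 0 < η := by positivity
  have hmono' : StrictMonoOn (fun u => u * ‖g u‖) (Ioo (-η) η) :=
    hmono.mono (Ioo_subset_Ioo (neg_le_neg (min_le_left _ _)) (min_le_left _ _))
  obtain ⟨d₀, hd₀, hd₀'⟩ := hh.exists_norm_sub_lower_bound hη0
  -- At an end point, `w = ρ ‖g‖` with `w = ±v`, so `(ρ g) ^ (-M) = (‖g‖ / g) ^ M / w ^ M` has a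
  -- numerator of class `C^M` in `w`.
  have hq : ContDiffAt ℝ M (fun v => 1 / (M : ℂ) * ((‖g (ρ v)‖ : ℂ) / g (ρ v)) ^ M) 0 := by
    have h1 : ContDiffAt ℝ M (fun v => g (ρ v)) 0 := by
      have := hg.contDiffAt.comp (0 : ℝ) hρ
      exact this
    have hne : g (ρ 0) ≠ 0 := by rw [hρ0]; exact hgne
    have h2 : ContDiffAt ℝ M (fun v => ((‖g (ρ v)‖ : ℝ) : ℂ)) 0 :=
      Complex.ofRealCLM.contDiff.contDiffAt.comp (0 : ℝ) (h1.norm ℝ hne)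
    simp only [div_eq_mul_inv]
    exact contDiffAt_const.mul ((h2.mul (h1.inv hne)).pow M)
  obtain ⟨d, hd⟩ := exists_tendsto_of_contDiffAt hq
  refine ⟨d, hd.congr' ?_⟩
  have hneg : Tendsto (fun v : ℝ => -v) (𝓝 0) (𝓝 0) := by
    simpa using (continuous_neg (G := ℝ)).tendsto 0
  have hρη : ∀ᶠ v in 𝓝 (0 : ℝ), ρ v ∈ Ioo (-η) η ∧ ρ v * ‖g (ρ v)‖ = v := by
    refine Filter.Eventually.and ?_ hsρ
    have : Tendsto ρ (𝓝 0) (𝓝 0) := by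
      simpa [hρ0] using hρ.continuousAt.tendsto
    exact this.eventually (Ioo_mem_nhds (by linarith) hη0)
  filter_upwards [nhdsWithin_le_nhds hρη, nhdsWithin_le_nhds (hneg.eventually hρη),
    Ioo_mem_nhdsGT hd₀] with v h1 h2 hv
  have hv0 : 0 < v := hv.1
  have h0mem : (0 : ℝ) ∈ Ioo (-η) η := ⟨by linarith, hη0⟩
  have hpos : 0 < ρ v := by
    rw [← hmono'.lt_iff_lt h0mem h1.1]
    simp only [zero_mul, h1.2, hv0]
  have hneg' : ρ (-v) < 0 := by
    rw [← hmono'.lt_iff_lt h2.1 h0mem]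
    simp only [zero_mul, h2.2]
    linarith
  have hη2 : η ≤ 1 / 2 := min_le_right _ _
  -- For `|u| < η` the signed distance is strictly monotone; for `|u| ≥ η` the distance is at least
  -- `d₀ > v`. The part cut off is thus a single arc.
  have hset : ∀ u ∈ Icc (-(1 / 2) : ℝ) (1 / 2), v < ‖γ u - γ 0‖ ↔ u < ρ (-v) ∨ ρ v < u := by
    intro u hu
    rcases lt_or_ge |u| η with hlt | hge
    · have hu' : u ∈ Ioo (-η) η := abs_lt.1 hlt
      rw [← habs, lt_abs, ← hmono'.lt_iff_lt hu' h2.1, ← hmono'.lt_iff_lt h1.1 hu', or_comm]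
      simp only [h1.2, h2.2]
      rw [lt_neg]
    · refine iff_of_true (hv.2.trans_le (hd₀' u hu hge)) ?_
      rcases le_abs.1 hge with h3 | h3
      · exact Or.inr (h1.1.2.trans_le h3)
      · exact Or.inl (lt_of_le_of_lt (by linarith) h2.1.1)
  rw [truncatedIntegral_one_eq_of_arc hM hh hv0 ⟨by linarith [h2.1.1], hneg'⟩
    ⟨hpos, by linarith [h1.1.2]⟩ hset, hgu, hgu]
  congr 1
  have key : ∀ w : ℝ, ρ w * ‖g (ρ w)‖ = w → w ≠ 0 →
      1 / (M : ℂ) * (((ρ w : ℂ) * g (ρ w)) ^ M)⁻¹ =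
        1 / (M : ℂ) * ((‖g (ρ w)‖ : ℂ) / g (ρ w)) ^ M / (w : ℂ) ^ M := by
    intro w hw hw0
    have hgn : g (ρ w) ≠ 0 := by
      intro h0; rw [h0] at hw; simp at hw; exact hw0 hw.symm
    have hρn : (ρ w : ℂ) ≠ 0 := by
      intro h0
      have : ρ w = 0 := by exact_mod_cast h0
      rw [this] at hw; simp at hw; exact hw0 hw.symm
    have hnn : (‖g (ρ w)‖ : ℂ) ≠ 0 := by simpa using hgn
    have hwc : (w : ℂ) = ρ w * ‖g (ρ w)‖ := by
      rw [← Complex.ofReal_mul, hw]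
    rw [hwc, mul_div_assoc, ← div_pow, ← inv_pow]
    congr 2
    field_simp
  rw [key v h1.2 hv0.ne', key (-v) h2.2 (neg_ne_zero.2 hv0.ne')]

end Contour

/-! ### The hypersingular integral of an analytic function -/

theorem analyticOnNhd_iterate_dslope {G : Set ℂ} (hG : IsOpen G) {φ : ℂ → ℂ}
    (hφ : AnalyticOnNhd ℂ φ G) {t : ℂ} (ht : t ∈ G) (k : ℕ) :
    AnalyticOnNhd ℂ ((Function.swap dslope t)^[k] φ) G := by
  induction k with
  | zero => exact hφ
  | succ k ih =>
    rw [Function.iterate_succ_apply']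
    exact DifferentiableOn.analyticOnNhd
      ((Complex.differentiableOn_dslope (hG.mem_nhds ht)).2 ih.differentiableOn) hG

theorem iterate_dslope_apply_self {φ : ℂ → ℂ} {t : ℂ} (hφ : AnalyticAt ℂ φ t) (k : ℕ) :
    (Function.swap dslope t)^[k] φ t = iteratedDeriv k φ t / k.factorial := by
  have h1 := hφ.hasFPowerSeriesAt.has_fpower_series_iterate_dslope_fslope k
  rw [← h1.coeff_zero 1]
  have h2 := FormalMultilinearSeries.coeff_iterate_fslope (p := FormalMultilinearSeries.ofScalars ℂ
    (fun n => iteratedDeriv n φ t / n.factorial)) k 0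
  rw [FormalMultilinearSeries.coeff, zero_add, FormalMultilinearSeries.coeff_ofScalars] at h2
  exact h2

/-- Telescoping of `g z = g t + (z - t) * dslope g t z`. No regularity is needed, as the value of
`dslope` at `z = t` is multiplied by zero. -/
theorem eq_sum_add_pow_mul_iterate_dslope (φ : ℂ → ℂ) (t z : ℂ) (k : ℕ) :
    φ z = ∑ j ∈ Finset.range k, (Function.swap dslope t)^[j] φ t * (z - t) ^ j +
      (z - t) ^ k * (Function.swap dslope t)^[k] φ z := by
  induction k with
  | zero => simp
  | succ k ih =>
    rw [ih, Finset.sum_range_succ, Function.iterate_succ_apply']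
    have h1 : (z - t) * dslope ((Function.swap dslope t)^[k] φ) t z =
        (Function.swap dslope t)^[k] φ z - (Function.swap dslope t)^[k] φ t := by
      rw [← smul_eq_mul, sub_smul_dslope]
    simp only [Function.swap] at h1 ⊢
    linear_combination -(z - t) ^ k * h1

section Contour

variable {γ : ℝ → ℂ}

/-- Every `u ≠ 0` of the period eventually lies outside the cut-off, and `‖F‖` dominates. -/
theorem tendsto_truncated_of_continuous (h : IsSmoothClosedContour 1 γ) {F : ℝ → ℂ}
    (hF : Continuous F) :
    Tendsto (fun v : ℝ => ∫ u in (-(1 / 2) : ℝ)..1 / 2, {u | v < ‖γ u - γ 0‖}.indicator F u)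
      (𝓝[>] 0) (𝓝 (∫ u in (-(1 / 2) : ℝ)..1 / 2, F u)) := by
  have hc : Continuous γ := h.contDiff.continuous
  refine intervalIntegral.tendsto_integral_filter_of_dominated_convergence (fun u => ‖F u‖)
    (Eventually.of_forall fun v => ?_) (Eventually.of_forall fun v => ?_)
    (hF.norm.intervalIntegrable _ _) ?_
  · exact hF.aestronglyMeasurable.indicator
      (isOpen_lt continuous_const (by fun_prop)).measurableSet
  · exact Eventually.of_forall fun u _ => norm_indicator_le_norm_self _ _
  · have hae : ∀ᵐ u : ℝ, u ∉ ({0} : Set ℝ) :=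
      MeasureTheory.measure_eq_zero_iff_ae_notMem.1 (by simp)
    filter_upwards [hae] with u hu hu'
    rw [uIoc_of_le (by norm_num)] at hu'
    have hne : 0 < ‖γ u - γ 0‖ := norm_pos_iff.2 (sub_ne_zero.2 (h.ne_of_mem hu ⟨hu'.1.le, hu'.2⟩))
    refine tendsto_const_nhds.congr' ?_
    filter_upwards [Ioo_mem_nhdsGT hne] with v hv
    rw [indicator_of_mem]
    exact hv.2

theorem truncatedIntegral_eq_sum_add (h : IsSmoothClosedContour 1 γ) {p : ℕ} {φ ψ : ℂ → ℂ}
    {c : ℕ → ℂ} (hψ : Continuous fun u => ψ (γ u))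
    (hφ : ∀ z, φ z = ∑ j ∈ Finset.range p, c j * (z - γ 0) ^ j + (z - γ 0) ^ p * ψ z)
    {v : ℝ} (hv : 0 < v) :
    truncatedIntegral γ p φ (γ 0) v =
      ∑ j ∈ Finset.range p, c j * truncatedIntegral γ (p - j) (fun _ => 1) (γ 0) v +
      ∫ u in (-(1 / 2) : ℝ)..1 / 2,
        {u | v < ‖γ u - γ 0‖}.indicator (fun u => ψ (γ u) * deriv γ u) u := by
  have hc : Continuous γ := h.contDiff.continuous
  have hg : Continuous (deriv γ) := h.contDiff.continuous_deriv le_rfl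
  simp only [truncatedIntegral_eq_symm_interval h.periodic hc, ← intervalIntegral.integral_const_mul]
  have hint : ∀ j ∈ Finset.range p, IntervalIntegrable (fun u => c j *
      {u | v < ‖γ u - γ 0‖}.indicator (fun u => 1 / (γ u - γ 0) ^ (p - j) * deriv γ u) u)
      MeasureTheory.volume (-(1 / 2)) (1 / 2) := by
    intro j _
    refine (intervalIntegrable_truncated hc (ContinuousOn.mul (ContinuousOn.div (by fun_prop)
      (by fun_prop) fun u hu => pow_ne_zero _ (sub_ne_zero.2 hu)) hg.continuousOn) hv _ _).const_mul _
  rw [← intervalIntegral.integral_finsetSum hint, ← intervalIntegral.integral_add]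
  · refine intervalIntegral.integral_congr fun u _ => ?_
    simp only [indicator, mem_ofPred_eq]
    split_ifs with hu
    · have hne : γ u - γ 0 ≠ 0 := norm_pos_iff.1 (hv.trans hu)
      rw [hφ, add_div, add_mul, Finset.sum_div, Finset.sum_mul,
        mul_div_cancel_left₀ _ (pow_ne_zero _ hne)]
      congr 1
      refine Finset.sum_congr rfl fun j hj => ?_
      rw [Finset.mem_range] at hj
      rw [← pow_sub_mul_pow _ hj.le]
      field_simp
    · simp
  · have := IntervalIntegrable.sum _ hint
    rwa [Finset.sum_fn] at this
  · exact intervalIntegrable_truncated hc (hψ.mul hg).continuousOn hv _ _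

theorem exists_tendsto_truncatedIntegral_one_of_le {p k : ℕ} (hk : 1 ≤ k) (hkp : k ≤ p)
    (h : IsSmoothClosedContour p γ) (hor : IsPositivelyOriented γ) :
    ∃ d : ℕ → ℂ, Tendsto (fun v : ℝ => truncatedIntegral γ k (fun _ => 1) (γ 0) v +
      ∑ i ∈ Finset.Icc 1 (p - 1), d i / (v : ℂ) ^ i) (𝓝[>] 0)
      (𝓝 (if k = 1 then Real.pi * Complex.I else 0)) := by
  have hle : ∀ q ≤ p, IsSmoothClosedContour q γ := fun q hq =>
    ⟨h.periodic, h.contDiff.of_le (by exact_mod_cast hq), h.deriv_ne_zero, h.injOn⟩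
  rcases eq_or_lt_of_le hk with rfl | hk1
  · refine ⟨0, ?_⟩
    simpa using tendsto_truncatedIntegral_one_one (hle 1 hkp) hor
  · obtain ⟨M, rfl⟩ := Nat.exists_eq_add_of_lt hk1
    rw [show 1 + M + 1 = (M + 1) + 1 by ring] at *
    obtain ⟨d, hd⟩ := exists_tendsto_truncatedIntegral_one (Nat.succ_ne_zero M)
      (hle (M + 1 + 1) hkp)
    -- Padding with zeros gives all `k ≤ p` the same range of divergent powers, so that the
    -- expansions can be added.
    refine ⟨fun i => if i ∈ Finset.Icc 1 (M + 1) then d i else 0, ?_⟩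
    rw [if_neg (by omega)]
    refine hd.congr fun v => ?_
    congr 1
    simp only [ite_div, zero_div]
    rw [← Finset.sum_filter]
    refine Finset.sum_congr ?_ fun _ _ => rfl
    ext i
    simp
    omega

/-- In the expansion of `φ` at `γ 0` only the term `j = p - 1` yields a simple pole, the one power
with nonzero finite part. The divergent parts combine linearly. -/
theorem hasHypersingularIntegral_apply_zero {p : ℕ} (hp : 1 ≤ p) (h : IsSmoothClosedContour p γ)
    (hor : IsPositivelyOriented γ) {G : Set ℂ} (hG : IsOpen G)
    (hsub : range γ ∪ innerDomain γ ⊆ G) {φ : ℂ → ℂ} (hφ : AnalyticOnNhd ℂ φ G) :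
    HasHypersingularIntegral γ p φ (γ 0) (Real.pi * Complex.I *
      (iteratedDeriv (p - 1) φ (γ 0) / (p - 1).factorial)) := by
  have h1 : IsSmoothClosedContour 1 γ :=
    ⟨h.periodic, h.contDiff.of_le (by exact_mod_cast hp), h.deriv_ne_zero, h.injOn⟩
  have ht : γ 0 ∈ G := hsub (Or.inl (mem_range_self 0))
  have hc : Continuous γ := h1.contDiff.continuous
  have hg : Continuous (deriv γ) := h1.contDiff.continuous_deriv le_rfl
  set ψ : ℂ → ℂ := (Function.swap dslope (γ 0))^[p] φ with hψ
  have hψG : AnalyticOnNhd ℂ ψ G := analyticOnNhd_iterate_dslope hG hφ ht p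
  have hψc : Continuous fun u => ψ (γ u) :=
    hψG.continuousOn.comp_continuous hc fun u => hsub (Or.inl (mem_range_self u))
  have hzero : ∫ u in (-(1 / 2) : ℝ)..1 / 2, ψ (γ u) * deriv γ u = 0 := by
    have hper : Function.Periodic (fun u => ψ (γ u) * deriv γ u) 1 := fun u => by
      simp only [h.periodic u, h.periodic.deriv_of_periodic u]
    have e := hper.intervalIntegral_add_eq 0 (-(1 / 2))
    norm_num at e ⊢
    rw [← e]
    have := integral_dslope_eq_zero h.periodic h1.contDiff hG hsub
      (analyticOnNhd_iterate_dslope hG hφ ht (p - 1)) ht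
    -- As a difference quotient of the previous iterate, `ψ` falls under Cauchy's theorem in the
    -- form proved above.
    have hs : ψ = dslope ((Function.swap dslope (γ 0))^[p - 1] φ) (γ 0) := by
      rw [hψ]
      conv_lhs => rw [← Nat.sub_add_cancel hp, Function.iterate_succ_apply']
    rw [hs]
    exact this
  have hd : ∀ j ∈ Finset.range p, ∃ d : ℕ → ℂ, Tendsto (fun v : ℝ =>
      truncatedIntegral γ (p - j) (fun _ => 1) (γ 0) v +
      ∑ i ∈ Finset.Icc 1 (p - 1), d i / (v : ℂ) ^ i) (𝓝[>] 0)
      (𝓝 (if p - j = 1 then Real.pi * Complex.I else 0)) := by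
    intro j hj
    rw [Finset.mem_range] at hj
    exact exists_tendsto_truncatedIntegral_one_of_le (by omega) (by omega) h hor
  choose! d hd using hd
  set c : ℕ → ℂ := fun j => (Function.swap dslope (γ 0))^[j] φ (γ 0) with hcdef
  refine ⟨fun i => ∑ j ∈ Finset.range p, c j * d j i, ?_⟩
  have hlim := (tendsto_finsetSum (Finset.range p) fun j hj => (hd j hj).const_mul (c j)).add
    (tendsto_truncated_of_continuous h1 (F := fun u => ψ (γ u) * deriv γ u) (hψc.mul hg))
  have hval : ∑ j ∈ Finset.range p, c j * (if p - j = 1 then (Real.pi * Complex.I : ℂ) else 0) +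
      ∫ u in (-(1 / 2) : ℝ)..1 / 2, ψ (γ u) * deriv γ u =
      Real.pi * Complex.I * (iteratedDeriv (p - 1) φ (γ 0) / (p - 1).factorial) := by
    rw [hzero, add_zero, Finset.sum_eq_single (p - 1)]
    · rw [if_pos (by omega), hcdef]
      simp only
      rw [iterate_dslope_apply_self (hφ _ ht)]
      ring
    · intro j hj hj'
      rw [Finset.mem_range] at hj
      rw [if_neg (by omega), mul_zero]
    · intro hj
      rw [Finset.mem_range] at hj
      omega
  rw [hval] at hlim
  refine hlim.congr' ?_
  filter_upwards [self_mem_nhdsWithin] with v (hv : 0 < v)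
  rw [truncatedIntegral_eq_sum_add h1 hψc
    (fun z => eq_sum_add_pow_mul_iterate_dslope φ (γ 0) z p) hv]
  simp only [mul_add, Finset.sum_add_distrib, Finset.mul_sum, Finset.sum_div]
  rw [Finset.sum_comm (s := Finset.Icc 1 (p - 1))]
  simp only [mul_div_assoc]
  ring

/-- The hypersingular integral of an analytic function. -/
theorem hasHypersingularIntegral_of_analytic {p : ℕ} (hp : 1 ≤ p) (h : IsSmoothClosedContour p γ)
    (hor : IsPositivelyOriented γ) {G : Set ℂ} (hG : IsOpen G)
    (hsub : range γ ∪ innerDomain γ ⊆ G) {φ : ℂ → ℂ} (hφ : AnalyticOnNhd ℂ φ G) {t : ℂ}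
    (ht : t ∈ range γ) :
    HasHypersingularIntegral γ p φ t (Real.pi * Complex.I *
      (iteratedDeriv (p - 1) φ t / (p - 1).factorial)) := by
  obtain ⟨u₀, rfl⟩ := ht
  have := hasHypersingularIntegral_apply_zero hp (h.shift u₀) (hor.shift h.periodic u₀) hG
    (by rw [innerDomain, range_shift]; exact hsub) hφ
  unfold HasHypersingularIntegral at this ⊢
  simpa only [truncatedIntegral_shift h.periodic h.contDiff.continuous, add_zero] using this

end Contour

/-! ### Uniqueness of the finite part and the equivalence of (A) and (B) -/

/-- In `y = 1 / v` the sum is a polynomial without constant term. A nonconstant polynomial is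
unbounded as `y → ∞`, so a finite limit forces it to be zero. -/
theorem eq_zero_of_tendsto_sum_inv_pow {c : ℕ → ℂ} {N : ℕ} {L : ℂ}
    (h : Tendsto (fun v : ℝ => ∑ k ∈ Finset.Icc 1 N, c k / (v : ℂ) ^ k) (𝓝[>] 0) (𝓝 L)) :
    L = 0 := by
  let P : Polynomial ℂ := ∑ k ∈ Finset.Icc 1 N, Polynomial.monomial k (c k)
  have hP : Tendsto (fun y : ℝ => P.eval (y : ℂ)) atTop (𝓝 L) := by
    refine (h.comp tendsto_inv_atTop_nhdsGT_zero).congr fun y => ?_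
    simp [P, Polynomial.eval_finsetSum, div_eq_mul_inv]
  have hdeg : P.degree ≤ 0 := by
    by_contra hdeg
    have h1 := Polynomial.tendsto_norm_atTop P (not_le.1 hdeg) (z := fun y : ℝ => (y : ℂ))
      (l := atTop) (by simpa using tendsto_abs_atTop_atTop)
    exact not_tendsto_nhds_of_tendsto_atTop h1 _ hP.norm
  have h0 : P.coeff 0 = 0 := by
    simp only [P, Polynomial.finsetSum_coeff, Polynomial.coeff_monomial]
    refine Finset.sum_eq_zero fun k hk => if_neg ?_
    have := (Finset.mem_Icc.1 hk).1
    omega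
  rw [Polynomial.eq_C_of_degree_le_zero hdeg, h0] at hP
  simp only [map_zero, Polynomial.eval_zero] at hP
  exact tendsto_nhds_unique hP tendsto_const_nhds

theorem HasHypersingularIntegral.unique {γ : ℝ → ℂ} {p : ℕ} {φ : ℂ → ℂ} {t I J : ℂ}
    (hI : HasHypersingularIntegral γ p φ t I) (hJ : HasHypersingularIntegral γ p φ t J) : I = J := by
  obtain ⟨c, hc⟩ := hI
  obtain ⟨d, hd⟩ := hJ
  refine sub_eq_zero.1 (eq_zero_of_tendsto_sum_inv_pow (c := fun k => c k - d k) (N := p - 1) ?_)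
  refine (hc.sub hd).congr fun v => ?_
  simp only [sub_div, Finset.sum_sub_distrib]
  ring

/-- The integro-differential equation on the contour is equivalent to the differential equation on
the contour. -/
theorem satisfiesIDE_iff_forall_mem_contour {γ : ℝ → ℂ} {p : ℕ} (hp : 1 ≤ p)
    (h : IsSmoothClosedContour p γ) (hor : IsPositivelyOriented γ) {G : Set ℂ} (hG : IsOpen G)
    (hsub : range γ ∪ innerDomain γ ⊆ G) (n m : ℕ) (a b : ℕ → ℂ → ℂ) (f : ℂ → ℂ) {x : ℂ → ℂ}
    (hx : AnalyticOnNhd ℂ x G) :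
    SatisfiesIDE γ p n m a b f x ↔ ∀ t ∈ range γ, odeOperator p n m a b x t = f t := by
  have hI : ∀ t ∈ range γ, ∀ l, HasHypersingularIntegral γ p (iteratedDeriv l x) t
      (Real.pi * Complex.I * (iteratedDeriv (l + p - 1) x t / (p - 1).factorial)) := by
    intro t ht l
    have := hasHypersingularIntegral_of_analytic hp h hor hG hsub
      (fun z hz => analyticAt_iteratedDeriv (hx z hz) l) ht
    rwa [iteratedDeriv_iteratedDeriv, show p - 1 + l = l + p - 1 by omega] at this
  have hterm : ∀ t l, b l t / (Real.pi * Complex.I) *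
      (Real.pi * Complex.I * (iteratedDeriv (l + p - 1) x t / (p - 1).factorial)) =
      b l t / (p - 1).factorial * iteratedDeriv (l + p - 1) x t := by
    intro t l
    have hpi : (Real.pi : ℂ) ≠ 0 := by exact_mod_cast Real.pi_ne_zero
    field_simp
  constructor
  · intro hide t ht
    obtain ⟨I, hII, heq⟩ := hide t ht
    rw [← heq, odeOperator]
    congr 1
    refine Finset.sum_congr rfl fun l hl => ?_
    rw [(hII l (by simpa [Nat.lt_succ_iff] using hl)).unique (hI t ht l), hterm]
  · intro hode t ht
    refine ⟨_, fun l _ => hI t ht l, ?_⟩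
    rw [← hode t ht, odeOperator]
    simp only [hterm]

/-- Identity theorem: both sides of (B) are analytic in the connected set `G`, and the contour, on
which they agree, accumulates at `γ 0`. -/
theorem satisfiesIDE_iff_satisfiesODE {γ : ℝ → ℂ} {p : ℕ} (hp : 1 ≤ p)
    (h : IsSmoothClosedContour p γ) (hor : IsPositivelyOriented γ) {G : Set ℂ} (hG : IsOpen G)
    (hGc : IsPreconnected G) (hsub : range γ ∪ innerDomain γ ⊆ G) {n m : ℕ} {a b : ℕ → ℂ → ℂ}
    {f : ℂ → ℂ} (ha : ∀ k ≤ n, AnalyticOnNhd ℂ (a k) G) (hb : ∀ l ≤ m, AnalyticOnNhd ℂ (b l) G)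
    (hf : AnalyticOnNhd ℂ f G) {x : ℂ → ℂ} (hx : AnalyticOnNhd ℂ x G) :
    SatisfiesIDE γ p n m a b f x ↔ SatisfiesODE G p n m a b f x := by
  rw [satisfiesIDE_iff_forall_mem_contour hp h hor hG hsub n m a b f hx]
  have hγG : range γ ⊆ G := subset_union_left.trans hsub
  refine ⟨fun hL => ?_, fun hG' t ht => hG' t (hγG ht)⟩
  have han : AnalyticOnNhd ℂ (odeOperator p n m a b x) G := by
    intro z hz
    have : odeOperator p n m a b x = fun z => ∑ j ∈ Finset.range (max n (m + p - 1) + 1),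
        totalCoefficient p n m a b j z * iteratedDeriv j x z :=
      funext fun z => odeOperator_eq_sum hp n m a b x z
    rw [this]
    exact Finset.analyticAt_fun_sum _ fun j _ =>
      (analyticOnNhd_totalCoefficient ha hb j z hz).fun_mul (analyticAt_iteratedDeriv (hx z hz) j)
  refine han.eqOn_of_preconnected_of_frequently_eq hf hGc (hγG (mem_range_self 0)) ?_
  -- Injectivity of `γ` near `0` ensures that the points of the contour approach `γ 0` without being
  -- equal to it.
  have htend : Tendsto γ (𝓝[≠] 0) (𝓝[≠] (γ 0)) := by
    rw [tendsto_nhdsWithin_iff]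
    refine ⟨(h.contDiff.continuous.tendsto 0).mono_left nhdsWithin_le_nhds, ?_⟩
    filter_upwards [self_mem_nhdsWithin, nhdsWithin_le_nhds (Icc_mem_nhds
      (show (-(1 / 2) : ℝ) < 0 by norm_num) (show (0 : ℝ) < 1 / 2 by norm_num))] with u hu hu'
    exact h.ne_of_mem hu hu'
  exact htend.frequently (Frequently.of_forall fun u => hL _ (mem_range_self u))

theorem mainTheorem5 (p n m : ℕ) (hp : 1 ≤ p)
    (γ : ℝ → ℂ) (hγ : IsSmoothClosedContour p γ) (hor : IsPositivelyOriented γ)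
    (G : Set ℂ) (hGo : IsOpen G) (hGc : IsConnected G) (hG : range γ ∪ innerDomain γ ⊆ G)
    (a b : ℕ → ℂ → ℂ) (f : ℂ → ℂ)
    (ha : ∀ k ≤ n, AnalyticOnNhd ℂ (a k) G) (hb : ∀ l ≤ m, AnalyticOnNhd ℂ (b l) G)
    (hf : AnalyticOnNhd ℂ f G) :
    -- the integro-differential equation on the contour is equivalent to the ODE
    (∀ x : ℂ → ℂ, AnalyticOnNhd ℂ x G →
      (SatisfiesIDE γ p n m a b f x ↔ SatisfiesODE G p n m a b f x)) ∧
    -- the order of the ODE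
    ((∃ z ∈ G, leadingCoefficient p n m a b z ≠ 0) →
      IsDiffOperatorOfOrder G (odeOperator p n m a b) (max n (m + p - 1))) ∧
    -- a solution of the Cauchy problem is determined by `s - r` further values at `c`
    (∀ c ∈ range γ, leadingCoefficient p n m a b c ≠ 0 →
      ∀ x₀ : Fin (max n m) → ℂ, ∀ x y : ℂ → ℂ,
        AnalyticOnNhd ℂ x G → SatisfiesODE G p n m a b f x →
        SatisfiesInitialConditions (max n m) c x₀ x →
        AnalyticOnNhd ℂ y G → SatisfiesODE G p n m a b f y →
        SatisfiesInitialConditions (max n m) c x₀ y →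
        (∀ j, max n m ≤ j → j < max n (m + p - 1) → iteratedDeriv j x c = iteratedDeriv j y c) →
        EqOn x y G) ∧
    -- the Cauchy problem, for either equation, has `s - r` free parameters
    (IsSimplyConnected G → (∀ z ∈ G, leadingCoefficient p n m a b z ≠ 0) →
      ∀ c ∈ range γ, ∀ x₀ : Fin (max n m) → ℂ,
        HasFreeParameters G
          {x | AnalyticOnNhd ℂ x G ∧ SatisfiesODE G p n m a b f x ∧
            SatisfiesInitialConditions (max n m) c x₀ x}
          (max n (m + p - 1) - max n m) ∧
        HasFreeParameters G
          {x | AnalyticOnNhd ℂ x G ∧ SatisfiesIDE γ p n m a b f x ∧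
            SatisfiesInitialConditions (max n m) c x₀ x}
          (max n (m + p - 1) - max n m)) := by
  have hγG : range γ ⊆ G := subset_union_left.trans hG
  have hA : ∀ j ≤ max n (m + p - 1), AnalyticOnNhd ℂ (totalCoefficient p n m a b j) G :=
    fun j _ => analyticOnNhd_totalCoefficient ha hb j
  have hlead := totalCoefficient_max hp n m a b
  have hequiv : ∀ x : ℂ → ℂ, AnalyticOnNhd ℂ x G →
      (SatisfiesIDE γ p n m a b f x ↔ SatisfiesODE G p n m a b f x) := fun x hx =>
    satisfiesIDE_iff_satisfiesODE hp hγ hor hGo hGc.isPreconnected hG ha hb hf hx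
  refine ⟨hequiv, ?_, ?_, ?_⟩
  · rintro ⟨z, hz, hne⟩
    exact ⟨totalCoefficient p n m a b, hA, ⟨z, hz, by rwa [hlead]⟩,
      fun x _ z _ => odeOperator_eq_sum hp n m a b x z⟩
  · intro c hc hne x₀ x y hx hxf hxc hy hyf hyc hxy
    refine eqOn_of_linear_ode (f := f) hGo hGc.isPreconnected (hγG hc) hA (by rwa [hlead]) hx hy
      (fun z hz => ?_) (fun z hz => ?_) fun j hj => ?_
    · rw [← odeOperator_eq_sum hp]; exact hxf z hz
    · rw [← odeOperator_eq_sum hp]; exact hyf z hz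
    · rcases lt_or_ge j (max n m) with h | h
      · exact (hxc ⟨j, h⟩).trans (hyc ⟨j, h⟩).symm
      · exact hxy j h hj
  · intro hGs hne c hc x₀
    have hfree : HasFreeParameters G
        {x | AnalyticOnNhd ℂ x G ∧ SatisfiesODE G p n m a b f x ∧
          SatisfiesInitialConditions (max n m) c x₀ x} (max n (m + p - 1) - max n m) := by
      unfold SatisfiesODE
      simp only [odeOperator_eq_sum hp]
      exact hasFreeParameters_linear_ode hGo hGs (by omega) hA hf
        (fun z hz => by rw [hlead]; exact hne z hz) (hγG hc) x₀
    refine ⟨hfree, ?_⟩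
    have hset : {x | AnalyticOnNhd ℂ x G ∧ SatisfiesIDE γ p n m a b f x ∧
          SatisfiesInitialConditions (max n m) c x₀ x} =
        {x | AnalyticOnNhd ℂ x G ∧ SatisfiesODE G p n m a b f x ∧
          SatisfiesInitialConditions (max n m) c x₀ x} := by
      ext x
      exact and_congr_right fun hx => and_congr_left fun _ => hequiv x hx
    rw [hset]
    exact hfree
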